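/- **Setting.** Let $d\in\{2,3\}$, $k\ge 1$, and let $\Omega\subset\mathbb R^d$ be a polygonal/polyhedral domain (the interior of a finite union of simplices). Write $\|\cdot\|$ and $(\cdot,\cdot)$ for the norm and scalar product of $L^2(\Omega)$, and $|v|_{H^m(\Omega)}=\|D^m v\|$. Let $V,W$ be subspaces of $H^1(\Omega)$ and $a:V\times W\to\mathbb R$ a bilinear form. For $f,g\in L^2(\Omega)$ consider the forward and the adjoint problem $$u\in V:\ a(u,w)=(f,w)\ \ \forall w\in W,\qquad\qquad z\in W:\ a(v,z)=(g,v)\ \ \forall v\in V .$$ Let $\mathcal T_h$ be a conforming triangulation of $\Omega$ into closed simplices with mesh size $h=\max_K h_K$, $h_K=\operatorname{diam}K$. It is shape regular and quasi-uniform with constants $\sigma,\tau$: each $K$ contains a ball of radius $r$ with $h_K\le\sigma r$, and $h\le\tau h_K$. Let $\|\cdot\|_h$ denote the elementwise $L^2$-norm. Let $V_h,W_h$ be subspaces of $X_h^k=\{v\in H^1(\Omega): v|_K\in\mathbb P_k(K)\ \forall K\in\mathcal T_h\}$ and put $$S_V=(V\cap H^2(\Omega))+V_h,\qquad S_W=(W\cap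 H^2(\Omega))+W_h .$$ Let $a_h:S_V\times S_W\to\mathbb R$ be bilinear. Let $s_p$ on $S_V$ and $s_a$ on $S_W$ be symmetric positive semidefinite bilinear forms, with $|v|_{S_p}=s_p(v,v)^{1/2}$ and $|w|_{S_a}=s_a(w,w)^{1/2}$. Let $\|\cdot\|_+$ and $\|\cdot\|_{\mathcal L}$ be seminorms on $S_V$, and $\|\cdot\|_*$ a seminorm on $S_W$. Let $\pi_V:V\to V_h$ and $\pi_W:W\to W_h$ be maps and $\epsilon(h)\ge0$ a real number. **Assumptions**, with positive constants $c_{a,\Omega},c_{a,\gamma},c_a,c_i$: 1. *(Well-posedness and smoothing.)* For all $f,g\in L^2(\Omega)$ the forward and the adjoint problem have exactly one solution $u$, respectively $z$. These lie in $H^2(\Omega)$, with $|u|_{H^2(\Omega)}\le c_{a,\Omega}\|f\|$ and $|z|_{H^2(\Omega)}\le c_{a,\Omega}\|g\|$. 2. *(Consistency.)* For all $f,g\in L^2(\Omega)$: if $u$ solves the forward problem with data $f$, then $a_h(u,\varphi)=(f,\varphi)$ for all $\varphi\in S_W$. If $z$ solves the adjoint problem with data $g$, then $a_h(\phi,z)=(\phi,g)$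 for all $\phi\in S_V$. 3. *(Interpolation.)* For $j=1$ and $j=k$, $$\|v-\pi v\|+h\|\nabla(v-\pi v)\|+h^2\|D^2(v-\pi v)\|_h\le c_i h^{j+1}|v|_{H^{j+1}(\Omega)}$$ for $\pi=\pi_V$, $v\in V\cap H^{j+1}(\Omega)$, and for $\pi=\pi_W$, $v\in W\cap H^{j+1}(\Omega)$. 4. *(Continuity.)* For all $v\in V\cap H^2(\Omega)$, $y\in W\cap H^2(\Omega)$, $v_h\in V_h$, $x_h\in W_h$, $$a_h(v-\pi_Vv,x_h)\le\|v-\pi_Vv\|_+\,(c_a|x_h|_{S_a}+\epsilon(h)\|x_h\|),$$ $$a_h(v-v_h,y-\pi_Wy)\le\|y-\pi_Wy\|_*\,(c_a\|v-\pi_Vv\|_{\mathcal L}+c_a|v_h-\pi_Vv|_{S_p}+\epsilon(h)\|v-v_h\|).$$ 5. *(Approximation.)* For $j=1$ and $j=k$, $$\|v-\pi_Vv\|_{\mathcal L}+\|v-\pi_Vv\|_++|v-\pi_Vv|_{S_p}\le c_{a,\gamma}h^j|v|_{H^{j+1}(\Omega)}\quad\forall v\in V\cap H^{j+1}(\Omega),$$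 $$\|w-\pi_Ww\|_*+|w-\pi_Ww|_{S_a}\le c_{a,\gamma}h^j|w|_{H^{j+1}(\Omega)}\quad\forall w\in W\cap H^{j+1}(\Omega),$$ and $|\pi_Ww|_{S_a}\le c_{a,\gamma}h|w|_{H^2(\Omega)}$ for all $w\in W\cap H^2(\Omega)$, and $|\pi_Vv|_{S_p}\le c_{a,\gamma}h|v|_{H^2(\Omega)}$ for all $v\in V\cap H^2(\Omega)$. **Theorem.** There are a constant $c_0>0$ depending only on $d,k,c_{a,\Omega},c_{a,\gamma}$ and a constant $C>0$ depending only on these and on $c_a,c_i,\sigma,\tau$ (in particular not on $h$), such that the following holds whenever the assumptions above are satisfied and $$c_0\,h\,\epsilon(h)\le\tfrac16 .$$ Let $f\in L^2(\Omega)$ and let $u\in V$ be the solution of the forward problem. Then there is exactly one pair $(u_h,z_h)\in V_h\times W_h$ with $$a_h(u_h,w_h)+s_a(z_h,w_h)=(f,w_h)\quad\forall w_h\in W_h,$$ $$a_h(v_h,z_h)-s_p(u_h,v_h)=-s_p(u,v_h)\quad\forall v_h\in V_h .$$ If $u\in H^{k+1}(\Omega)$, it satisfies $$\|u-u_h\|+h\|\nabla(u-u_h)\|+\|z_h\|\le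 C\,h^{k+1}|u|_{H^{k+1}(\Omega)},$$ and in any case $$\|u-u_h\|+h\|\nabla(u-u_h)\|+\|z_h\|\le C\,h^2\|f\|.$$ -/

import Mathlib

open MeasureTheory Geometry
open scoped ContDiff

noncomputable section

/-! ## Sobolev spaces through weak derivatives -/

/-- Euclidean space of dimension `d`. -/
abbrev E (d : ℕ) : Type := EuclideanSpace ℝ (Fin d)

/-- The (classical) partial derivative `∂_{i 0} ⋯ ∂_{i (m-1)} φ` of order `m`. -/
def partialDeriv {d m : ℕ} (i : Fin m → Fin d) (φ : E d → ℝ) (x : E d) : ℝ :=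
  iteratedFDeriv ℝ m φ x fun j => EuclideanSpace.single (i j) (1 : ℝ)

/-- Test functions: smooth with compact support in `U`. -/
structure IsTest {d : ℕ} (U : Set (E d)) (φ : E d → ℝ) : Prop where
  smooth : ContDiff ℝ ∞ φ
  compact : HasCompactSupport φ
  support : tsupport φ ⊆ U

/-- `g` is a square integrable weak derivative `∂_{i 0} ⋯ ∂_{i (m-1)} v` on `U`. -/
def HasWeakDeriv {d m : ℕ} (U : Set (E d)) (i : Fin m → Fin d) (v g : E d → ℝ) : Prop :=
  MemLp g 2 (volume.restrict U) ∧
    ∀ φ : E d → ℝ, IsTest U φ →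
      ∫ x in U, v x * partialDeriv i φ x = (-1) ^ m * ∫ x in U, g x * φ x

open Classical in
/-- The weak derivative (unique up to null sets of the open set `U`, when it exists). -/
def weakDeriv {d m : ℕ} (U : Set (E d)) (i : Fin m → Fin d) (v : E d → ℝ) : E d → ℝ :=
  if h : ∃ g, HasWeakDeriv U i v g then h.choose else 0

/-- The seminorm `|v|_{H^m(U)} = ‖D^m v‖_{L²(U)}`, with the Frobenius norm of the tensor `D^m v`;
for `m = 1` this is `‖∇ v‖`. -/
def hSeminorm {d : ℕ} (U : Set (E d)) (m : ℕ) (v : E d → ℝ) : ℝ :=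
  Real.sqrt (∑ i : Fin m → Fin d, ∫ x in U, (weakDeriv U i v x) ^ 2)

/-- `L²(Ω)`, with its norm `‖·‖` and scalar product. -/
abbrev L2 {d : ℕ} (Ω : Set (E d)) : Type := Lp ℝ 2 (volume.restrict Ω)

lemma partialDeriv_memLp {d m : ℕ} (U : Set (E d)) (i : Fin m → Fin d) {φ : E d → ℝ}
    (h : IsTest U φ) : MemLp (partialDeriv i φ) 2 (volume.restrict U) := by
  have hc : Continuous (partialDeriv i φ) := by
    have h1 : Continuous (iteratedFDeriv ℝ m φ) :=
      h.smooth.continuous_iteratedFDeriv (by exact_mod_cast le_top)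
    have h2 : Continuous fun L : (E d) [×m]→L[ℝ] ℝ =>
        L fun j => EuclideanSpace.single (i j) (1 : ℝ) :=
      (ContinuousMultilinearMap.apply ℝ (fun _ : Fin m => E d) ℝ
        fun j => EuclideanSpace.single (i j) (1 : ℝ)).continuous
    exact h2.comp h1
  have hs : HasCompactSupport (partialDeriv i φ) := by
    have h1 : HasCompactSupport (iteratedFDeriv ℝ m φ) := h.compact.iteratedFDeriv m
    exact h1.comp_left
      (g := fun L : (E d) [×m]→L[ℝ] ℝ => L fun j => EuclideanSpace.single (i j) (1 : ℝ)) (by simp)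
  exact (hc.memLp_of_hasCompactSupport hs).restrict U

lemma test_memLp {d : ℕ} (U : Set (E d)) {φ : E d → ℝ} (h : IsTest U φ) :
    MemLp φ 2 (volume.restrict U) :=
  (h.smooth.continuous.memLp_of_hasCompactSupport h.compact).restrict U

lemma HasWeakDeriv.add {d m : ℕ} {U : Set (E d)} {i : Fin m → Fin d} {v w g k : E d → ℝ}
    (hv : MemLp v 2 (volume.restrict U)) (hw : MemLp w 2 (volume.restrict U))
    (hg : HasWeakDeriv U i v g) (hk : HasWeakDeriv U i w k) :
    HasWeakDeriv U i (v + w) (g + k) := by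
  refine ⟨hg.1.add hk.1, fun φ hφ => ?_⟩
  have a1 := hv.integrable_mul (partialDeriv_memLp U i hφ)
  have a2 := hw.integrable_mul (partialDeriv_memLp U i hφ)
  have a3 := hg.1.integrable_mul (test_memLp U hφ)
  have a4 := hk.1.integrable_mul (test_memLp U hφ)
  have e1 : ∫ x in U, (v + w) x * partialDeriv i φ x =
      (∫ x in U, v x * partialDeriv i φ x) + ∫ x in U, w x * partialDeriv i φ x := by
    refine Eq.trans ?_ (integral_add a1 a2)
    simp only [Pi.add_apply, Pi.mul_apply, add_mul]
  have e2 : ∫ x in U, (g + k) x * φ x = (∫ x in U, g x * φ x) + ∫ x in U, k x * φ x := by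
    refine Eq.trans ?_ (integral_add a3 a4)
    simp only [Pi.add_apply, Pi.mul_apply, add_mul]
  rw [e1, e2, hg.2 φ hφ, hk.2 φ hφ, mul_add]

lemma HasWeakDeriv.smul {d m : ℕ} {U : Set (E d)} {i : Fin m → Fin d} {v g : E d → ℝ} (c : ℝ)
    (hg : HasWeakDeriv U i v g) : HasWeakDeriv U i (c • v) (c • g) := by
  refine ⟨hg.1.const_smul c, fun φ hφ => ?_⟩
  simp only [Pi.smul_apply, smul_eq_mul, mul_assoc, integral_const_mul, hg.2 φ hφ]
  ring

lemma HasWeakDeriv.congr {d m : ℕ} {U : Set (E d)} {i : Fin m → Fin d} {v w g : E d → ℝ}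
    (h : v =ᵐ[volume.restrict U] w) (hg : HasWeakDeriv U i v g) : HasWeakDeriv U i w g := by
  refine ⟨hg.1, fun φ hφ => ?_⟩
  rw [← hg.2 φ hφ]
  exact integral_congr_ae (h.symm.mono fun x hx => by simp only [hx])

/-- The Sobolev space `H^m(Ω)`: all weak derivatives of order at most `m` exist and are square
integrable. -/
def H {d : ℕ} (Ω : Set (E d)) (m : ℕ) : Submodule ℝ (L2 Ω) where
  carrier := {v | ∀ n ≤ m, ∀ i : Fin n → Fin d, ∃ g, HasWeakDeriv Ω i v g}
  add_mem' := by
    intro v w hv hw n hn i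
    obtain ⟨g, hg⟩ := hv n hn i
    obtain ⟨k, hk⟩ := hw n hn i
    exact ⟨g + k, (hg.add (Lp.memLp v) (Lp.memLp w) hk).congr (Lp.coeFn_add v w).symm⟩
  zero_mem' := by
    intro n _ i
    refine ⟨0, HasWeakDeriv.congr (Lp.coeFn_zero ℝ 2 _).symm ⟨MemLp.zero, fun φ _ => by simp⟩⟩
  smul_mem' := by
    intro c v hv n hn i
    obtain ⟨g, hg⟩ := hv n hn i
    exact ⟨c • g, (hg.smul c).congr (Lp.coeFn_smul c v).symm⟩

/-! ## Triangulations and finite element spaces -/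

/-- The elements of a simplicial complex, given by their vertices: its simplices of full
dimension. The element itself is the closed simplex `convexHull ℝ K`. -/
def elements {d : ℕ} (T : SimplicialComplex ℝ (E d)) : Set (Finset (E d)) :=
  {K | K ∈ T.faces ∧ K.card = d + 1}

/-- `T` is a (finite, conforming) triangulation of the polygonal/polyhedral set `Ω`. -/
structure IsTriangulation {d : ℕ} (Ω : Set (E d)) (T : SimplicialComplex ℝ (E d)) : Prop where
  finite : T.faces.Finite
  /-- every simplex is a face of an element -/
  pure : ∀ s ∈ T.faces, ∃ K ∈ elements T, s ⊆ K
  /-- the elements fill the polyhedral domain `Ω` -/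
  covers : interior (⋃ K ∈ elements T, convexHull ℝ (K : Set (E d))) = Ω

/-- The diameter `h_K` of an element. -/
def elementDiam {d : ℕ} (K : Finset (E d)) : ℝ := Metric.diam (convexHull ℝ (K : Set (E d)))

/-- The mesh size `h = max_K h_K`. -/
def meshSize {d : ℕ} (T : SimplicialComplex ℝ (E d)) : ℝ := sSup (elementDiam '' elements T)

/-- Shape regularity: each element contains a ball of radius comparable to its diameter. -/
def ShapeRegular {d : ℕ} (T : SimplicialComplex ℝ (E d)) (σ : ℝ) : Prop :=
  ∀ K ∈ elements T, ∃ (x : E d) (r : ℝ),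
    Metric.closedBall x r ⊆ convexHull ℝ (K : Set (E d)) ∧ elementDiam K ≤ σ * r

/-- Quasi-uniformity: all elements have a diameter comparable to the mesh size. -/
def QuasiUniform {d : ℕ} (T : SimplicialComplex ℝ (E d)) (τ : ℝ) : Prop :=
  ∀ K ∈ elements T, meshSize T ≤ τ * elementDiam K

/-- `v` coincides on the element `K` with a polynomial of degree at most `k`. -/
def IsPolyOn {d : ℕ} (k : ℕ) (K : Finset (E d)) (v : E d → ℝ) : Prop :=
  ∃ p : MvPolynomial (Fin d) ℝ, p.totalDegree ≤ k ∧
    v =ᵐ[volume.restrict (interior (convexHull ℝ (K : Set (E d))))]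
      fun x => MvPolynomial.eval (fun i => x i) p

/-- The elementwise (broken) seminorm `‖D^m v‖_h`. -/
def brokenSeminorm {d : ℕ} (T : SimplicialComplex ℝ (E d)) (m : ℕ) (v : E d → ℝ) : ℝ :=
  Real.sqrt (∑ᶠ K ∈ elements T, hSeminorm (interior (convexHull ℝ (K : Set (E d)))) m v ^ 2)

/-- `X_h^k` as a set of functions: `v ∈ H¹(Ω)` with `v|_K ∈ ℙ_k(K)` for all elements `K`. -/
def IsFEFunction {d : ℕ} {Ω : Set (E d)} (T : SimplicialComplex ℝ (E d)) (k : ℕ) (v : L2 Ω) :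
    Prop :=
  v ∈ H Ω 1 ∧ ∀ K ∈ elements T, IsPolyOn k K v

/-! ## The continuous problem -/

/-- The data of the weak formulation: subspaces `V, W` of `H¹(Ω)` and a bilinear form on
`V × W`. -/
structure Problem {d : ℕ} (Ω : Set (E d)) where
  V : Submodule ℝ (L2 Ω)
  W : Submodule ℝ (L2 Ω)
  V_le : V ≤ H Ω 1
  W_le : W ≤ H Ω 1
  a : V →ₗ[ℝ] W →ₗ[ℝ] ℝ

namespace Problem

variable {d : ℕ} {Ω : Set (E d)} (P : Problem Ω)

/-- `u ∈ V` solves the forward problem `a(u, w) = (f, w)` for all `w ∈ W`. -/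
def IsForwardSol (f : L2 Ω) (u : P.V) : Prop :=
  ∀ w : P.W, P.a u w = inner ℝ f (w : L2 Ω)

/-- `z ∈ W` solves the adjoint problem `a(v, z) = (g, v)` for all `v ∈ V`. -/
def IsAdjointSol (g : L2 Ω) (z : P.W) : Prop :=
  ∀ v : P.V, P.a v z = inner ℝ g (v : L2 Ω)

/-- Both problems have exactly one solution for all square integrable data. -/
structure WellPosed : Prop where
  forward : ∀ f : L2 Ω, ∃! u : P.V, P.IsForwardSol f u
  adjoint : ∀ g : L2 Ω, ∃! z : P.W, P.IsAdjointSol g z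

/-- The smoothing property with constant `c`: solutions are in `H²(Ω)`, with seminorm bounded
by `c` times the norm of the data. -/
structure Smoothing (c : ℝ) : Prop where
  forward : ∀ (f : L2 Ω) (u : P.V), P.IsForwardSol f u →
    (u : L2 Ω) ∈ H Ω 2 ∧ hSeminorm Ω 2 (u : L2 Ω) ≤ c * ‖f‖
  adjoint : ∀ (g : L2 Ω) (z : P.W), P.IsAdjointSol g z →
    (z : L2 Ω) ∈ H Ω 2 ∧ hSeminorm Ω 2 (z : L2 Ω) ≤ c * ‖g‖

end Problem

/-! ## The discretisation -/

/-- The data of the stabilised method on one mesh: discrete spaces `V_h, W_h ⊆ X_h^k`, the discrete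
bilinear form `a_h`, the symmetric positive semidefinite stabilisations `s_p`, `s_a`, interpolation
operators `π_V`, `π_W`, and the seminorms `‖·‖_+`, `‖·‖_ℒ`, `‖·‖_*`. The forms and seminorms are
defined for sums of `H²` functions of `V` (resp. `W`) and of discrete functions. -/
structure Discretisation {d : ℕ} {Ω : Set (E d)} (P : Problem Ω) (T : SimplicialComplex ℝ (E d))
    (k : ℕ) where
  Vh : Submodule ℝ (L2 Ω)
  Wh : Submodule ℝ (L2 Ω)
  Vh_fe : ∀ v ∈ Vh, IsFEFunction T k v
  Wh_fe : ∀ w ∈ Wh, IsFEFunction T k w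
  ah : ↥((P.V ⊓ H Ω 2) ⊔ Vh) →ₗ[ℝ] ↥((P.W ⊓ H Ω 2) ⊔ Wh) →ₗ[ℝ] ℝ
  sp : ↥((P.V ⊓ H Ω 2) ⊔ Vh) →ₗ[ℝ] ↥((P.V ⊓ H Ω 2) ⊔ Vh) →ₗ[ℝ] ℝ
  sa : ↥((P.W ⊓ H Ω 2) ⊔ Wh) →ₗ[ℝ] ↥((P.W ⊓ H Ω 2) ⊔ Wh) →ₗ[ℝ] ℝ
  sp_symm : ∀ v w, sp v w = sp w v
  sa_symm : ∀ v w, sa v w = sa w v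
  sp_nonneg : ∀ v, 0 ≤ sp v v
  sa_nonneg : ∀ v, 0 ≤ sa v v
  piV : P.V → Vh
  piW : P.W → Wh
  normPlus : Seminorm ℝ ↥((P.V ⊓ H Ω 2) ⊔ Vh)
  normL : Seminorm ℝ ↥((P.V ⊓ H Ω 2) ⊔ Vh)
  normStar : Seminorm ℝ ↥((P.W ⊓ H Ω 2) ⊔ Wh)

namespace Discretisation

variable {d k : ℕ} {Ω : Set (E d)} {P : Problem Ω} {T : SimplicialComplex ℝ (E d)}
  (D : Discretisation P T k)

/-- The space `(V ∩ H²(Ω)) + V_h`. -/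
abbrev SV : Submodule ℝ (L2 Ω) := (P.V ⊓ H Ω 2) ⊔ D.Vh

/-- The space `(W ∩ H²(Ω)) + W_h`. -/
abbrev SW : Submodule ℝ (L2 Ω) := (P.W ⊓ H Ω 2) ⊔ D.Wh

/-- Inclusion of `V ∩ H²(Ω)`. -/
def incV (v : P.V) (hv : (v : L2 Ω) ∈ H Ω 2) : D.SV :=
  ⟨v, Submodule.mem_sup_left ⟨v.2, hv⟩⟩

/-- Inclusion of `W ∩ H²(Ω)`. -/
def incW (w : P.W) (hw : (w : L2 Ω) ∈ H Ω 2) : D.SW :=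
  ⟨w, Submodule.mem_sup_left ⟨w.2, hw⟩⟩

/-- Inclusion of `V_h`. -/
def discV (v : D.Vh) : D.SV := ⟨v, Submodule.mem_sup_right v.2⟩

/-- Inclusion of `W_h`. -/
def discW (w : D.Wh) : D.SW := ⟨w, Submodule.mem_sup_right w.2⟩

/-- The stabilisation seminorm `|v|_{S_p} = s_p(v, v)^{1/2}`. -/
def seminormP (v : D.SV) : ℝ := Real.sqrt (D.sp v v)

/-- The stabilisation seminorm `|w|_{S_a} = s_a(w, w)^{1/2}`. -/
def seminormA (w : D.SW) : ℝ := Real.sqrt (D.sa w w)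

/-- Strong consistency of `a_h` with the forward and the adjoint problem
(for solutions `u`, `z` one has `ℒ u = f`, `ℒ* z = g`). -/
structure Consistent : Prop where
  forward : ∀ (f : L2 Ω) (u : P.V) (hu : (u : L2 Ω) ∈ H Ω 2), P.IsForwardSol f u →
    ∀ φ : D.SW, D.ah (D.incV u hu) φ = inner ℝ f (φ : L2 Ω)
  adjoint : ∀ (g : L2 Ω) (z : P.W) (hz : (z : L2 Ω) ∈ H Ω 2), P.IsAdjointSol g z →
    ∀ φ : D.SV, D.ah φ (D.incW z hz) = inner ℝ (φ : L2 Ω) g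

/-- The interpolation estimate
`‖v - πv‖ + h ‖∇(v - πv)‖ + h² ‖D²(v - πv)‖_h ≤ c h^{j+1} |v|_{H^{j+1}(Ω)}`
for `π = π_V, π_W` and the orders `j = 1` and `j = k`. -/
structure Interpolation (c : ℝ) : Prop where
  piV : ∀ j, j = 1 ∨ j = k → ∀ v : P.V, (v : L2 Ω) ∈ H Ω (j + 1) →
    ‖(v : L2 Ω) - D.piV v‖
      + meshSize T * hSeminorm Ω 1 ((v : L2 Ω) - D.piV v : L2 Ω)
      + meshSize T ^ 2 * brokenSeminorm T 2 ((v : L2 Ω) - D.piV v : L2 Ω)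
      ≤ c * meshSize T ^ (j + 1) * hSeminorm Ω (j + 1) (v : L2 Ω)
  piW : ∀ j, j = 1 ∨ j = k → ∀ w : P.W, (w : L2 Ω) ∈ H Ω (j + 1) →
    ‖(w : L2 Ω) - D.piW w‖
      + meshSize T * hSeminorm Ω 1 ((w : L2 Ω) - D.piW w : L2 Ω)
      + meshSize T ^ 2 * brokenSeminorm T 2 ((w : L2 Ω) - D.piW w : L2 Ω)
      ≤ c * meshSize T ^ (j + 1) * hSeminorm Ω (j + 1) (w : L2 Ω)

/-- The continuity relations of `a_h`, with constants `c` and `ε = ε(h)`. -/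
structure Continuity (c ε : ℝ) : Prop where
  cont1 : ∀ (v : P.V) (hv : (v : L2 Ω) ∈ H Ω 2) (x : D.Wh),
    D.ah (D.incV v hv - D.discV (D.piV v)) (D.discW x)
      ≤ D.normPlus (D.incV v hv - D.discV (D.piV v))
        * (c * D.seminormA (D.discW x) + ε * ‖(x : L2 Ω)‖)
  cont2 : ∀ (v : P.V) (hv : (v : L2 Ω) ∈ H Ω 2) (y : P.W) (hy : (y : L2 Ω) ∈ H Ω 2) (vh : D.Vh),
    D.ah (D.incV v hv - D.discV vh) (D.incW y hy - D.discW (D.piW y))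
      ≤ D.normStar (D.incW y hy - D.discW (D.piW y))
        * (c * D.normL (D.incV v hv - D.discV (D.piV v))
          + c * D.seminormP (D.discV vh - D.discV (D.piV v))
          + ε * ‖(v : L2 Ω) - vh‖)

/-- The approximation estimates for the seminorms, for the orders `j = 1` and `j = k`, and the
upper bounds for the stabilisation of interpolants, with constant `c`. -/
structure Approximation (c : ℝ) : Prop where
  approx1 : ∀ j, j = 1 ∨ j = k → ∀ (v : P.V) (hv : (v : L2 Ω) ∈ H Ω 2),
    (v : L2 Ω) ∈ H Ω (j + 1) →
      D.normL (D.incV v hv - D.discV (D.piV v))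
        + D.normPlus (D.incV v hv - D.discV (D.piV v))
        + D.seminormP (D.incV v hv - D.discV (D.piV v))
        ≤ c * meshSize T ^ j * hSeminorm Ω (j + 1) (v : L2 Ω)
  approx2 : ∀ j, j = 1 ∨ j = k → ∀ (w : P.W) (hw : (w : L2 Ω) ∈ H Ω 2),
    (w : L2 Ω) ∈ H Ω (j + 1) →
      D.normStar (D.incW w hw - D.discW (D.piW w))
        + D.seminormA (D.incW w hw - D.discW (D.piW w))
        ≤ c * meshSize T ^ j * hSeminorm Ω (j + 1) (w : L2 Ω)
  boundW : ∀ w : P.W, (w : L2 Ω) ∈ H Ω 2 →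
    D.seminormA (D.discW (D.piW w)) ≤ c * meshSize T * hSeminorm Ω 2 (w : L2 Ω)
  boundV : ∀ v : P.V, (v : L2 Ω) ∈ H Ω 2 →
    D.seminormP (D.discV (D.piV v)) ≤ c * meshSize T * hSeminorm Ω 2 (v : L2 Ω)

/-- `(u_h, z_h)` solves the stabilised primal-dual system with data `f` and exact solution `u`. -/
def IsFEMSol (f : L2 Ω) (u : P.V) (hu : (u : L2 Ω) ∈ H Ω 2) (p : D.Vh × D.Wh) : Prop :=
  (∀ wh : D.Wh, D.ah (D.discV p.1) (D.discW wh) + D.sa (D.discW p.2) (D.discW wh)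
    = inner ℝ f (wh : L2 Ω)) ∧
  (∀ vh : D.Vh, D.ah (D.discV vh) (D.discW p.2) - D.sp (D.discV p.1) (D.discV vh)
    = - D.sp (D.incV u hu) (D.discV vh))

/-- The error quantity `‖u - u_h‖ + h ‖∇(u - u_h)‖ + ‖z_h‖`. -/
def totalError (u : P.V) (p : D.Vh × D.Wh) : ℝ :=
  ‖(u : L2 Ω) - p.1‖ + meshSize T * hSeminorm Ω 1 ((u : L2 Ω) - p.1 : L2 Ω) + ‖(p.2 : L2 Ω)‖

end Discretisation

end

/-!
Testing the discrete system with `(w_h, v_h) = (z_h, u_h - π_V u)` cancels the indefinite form `a_h`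
and bounds `|z_h|_{S_a}` and `|u_h - π_V u|_{S_p}` by the approximation error of `u`, up to a term
`ε(h) ‖z_h‖`. The `L²` norms come from two duality arguments: take `z_h` as data of a forward
problem and `u - u_h` as data of an adjoint problem; by `H²` regularity the interpolation errors of
their solutions gain a factor `h`. Both estimates contain a multiple of `h ε(h)` times the norm to
be bounded, and this term is absorbed when `h ε(h)` is small. The gradient of the error follows from
an inverse inequality for piecewise polynomials. Finally the discrete system is square and
finite-dimensional, so the estimate for zero data, which gives uniqueness, also gives existence.
-/

section RealEstimates

lemma le_add_of_sq_le_mul_add_sq {a b c : ℝ} (hb : 0 ≤ b) (hc : 0 ≤ c)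
    (h : a ^ 2 ≤ b * a + c ^ 2) : a ≤ b + c := by
  by_contra! hlt
  nlinarith

lemma le_of_sq_le_mul_self {a b : ℝ} (hb : 0 ≤ b) (h : a ^ 2 ≤ b * a) : a ≤ b := by
  simpa using le_add_of_sq_le_mul_add_sq (c := 0) hb le_rfl (by simpa using h)

lemma le_mul_of_le_mul_add_mul {q t ε B : ℝ} (hq : 0 ≤ q) (htε : t * ε ≤ 1 / 6)
    (h : q ≤ t * (B + ε * q)) : q ≤ 6 / 5 * (t * B) := by
  have habsorb : t * ε * q ≤ 1 / 6 * q := mul_le_mul_of_nonneg_right htε hq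
  linarith

end RealEstimates

section SquareIntegrable

variable {α : Type*} {mα : MeasurableSpace α} {μ : Measure α}

lemma norm_sq_eq_integral_sq (v : Lp ℝ 2 μ) : ‖v‖ ^ 2 = ∫ x, v x ^ 2 ∂μ := by
  rw [← real_inner_self_eq_norm_sq, L2.inner_def]
  simp only [real_inner_self_eq_norm_sq, Real.norm_eq_abs, sq_abs]

lemma norm_toLp_sq {f : α → ℝ} (hf : MemLp f 2 μ) : ‖hf.toLp f‖ ^ 2 = ∫ x, f x ^ 2 ∂μ := by
  rw [norm_sq_eq_integral_sq]
  exact integral_congr_ae (hf.coeFn_toLp.mono fun x hx => congrArg (· ^ 2) hx)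

lemma integral_sq_congr_ae {f g : α → ℝ} (h : f =ᵐ[μ] g) :
    ∫ x, f x ^ 2 ∂μ = ∫ x, g x ^ 2 ∂μ :=
  integral_congr_ae (h.mono fun _ hx => congrArg (· ^ 2) hx)

end SquareIntegrable

lemma memLp_restrict_of_continuous_of_isBounded {X F : Type*} [PseudoMetricSpace X] [ProperSpace X]
    [MeasurableSpace X] [OpensMeasurableSpace X] [NormedAddCommGroup F]
    [SecondCountableTopologyEither X F] {μ : Measure X} [IsFiniteMeasureOnCompacts μ]
    {f : X → F} (hf : Continuous f) {U : Set X} (hU : Bornology.IsBounded U) (q : ENNReal) :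
    MemLp f q (μ.restrict U) := by
  rcases U.eq_empty_or_nonempty with rfl | ⟨x, -⟩
  · simp
  obtain ⟨R, hR⟩ := hU.subset_closedBall x
  have hK := isCompact_closedBall x R
  obtain ⟨M, hM⟩ := hK.exists_bound_of_continuousOn hf.continuousOn
  have : IsFiniteMeasure (μ.restrict (Metric.closedBall x R)) := ⟨by simpa using hK.measure_lt_top⟩
  exact (MemLp.of_bound hf.aestronglyMeasurable M
    ((ae_restrict_iff' Metric.isClosed_closedBall.measurableSet).2 (.of_forall hM))).mono_measure
      (Measure.restrict_mono hR le_rfl)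

open scoped Pointwise in
lemma setIntegral_comp_add_smul {V F : Type*} [NormedAddCommGroup V] [NormedSpace ℝ V]
    [FiniteDimensional ℝ V] [MeasurableSpace V] [BorelSpace V] [NormedAddCommGroup F]
    [NormedSpace ℝ F] (μ : Measure V) [μ.IsAddHaarMeasure] (f : V → F) (U : Set V) (x : V) {r : ℝ}
    (hr : 0 < r) :
    ∫ y in (fun y => x + r • y) ⁻¹' U, f (x + r • y) ∂μ =
      (r ^ Module.finrank ℝ V)⁻¹ • ∫ y in U, f y ∂μ := by
  have himage : r • ((fun y => x + r • y) ⁻¹' U) = (fun y => x + y) ⁻¹' U := by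
    ext y
    simp [Set.mem_smul_set_iff_inv_smul_mem₀ hr.ne', smul_inv_smul₀ hr.ne']
  rw [Measure.setIntegral_comp_smul_of_pos μ (fun y => f (x + y)) _ hr, himage,
    (measurePreserving_add_left μ x).setIntegral_preimage_emb (measurableEmbedding_addLeft x)]

lemma exists_norm_le_mul_norm_of_injective {𝕜 V X Y : Type*} [NontriviallyNormedField 𝕜]
    [CompleteSpace 𝕜] [AddCommGroup V] [Module 𝕜 V] [FiniteDimensional 𝕜 V]
    [NormedAddCommGroup X] [NormedSpace 𝕜 X] [SeminormedAddCommGroup Y] [NormedSpace 𝕜 Y]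
    {S : V →ₗ[𝕜] X} (hS : Function.Injective S) (T : V →ₗ[𝕜] Y) :
    ∃ C : ℝ, 0 ≤ C ∧ ∀ v, ‖T v‖ ≤ C * ‖S v‖ := by
  let e := LinearEquiv.ofInjective S hS
  let R := LinearMap.toContinuousLinearMap (T ∘ₗ e.symm.toLinearMap)
  exact ⟨‖R‖, norm_nonneg R, fun v => by simpa [R, e] using R.le_opNorm (e v)⟩

section PrimalDualMap

variable {K V W : Type*} [Field K] [AddCommGroup V] [Module K V] [AddCommGroup W] [Module K W]

/-- The operator `(v, w) ↦ (a(v, ·) + s(w, ·), a(·, w) - t(v, ·))` of a stabilised primal-dual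
system. -/
def primalDualMap (a : V →ₗ[K] W →ₗ[K] K) (s : W →ₗ[K] W →ₗ[K] K) (t : V →ₗ[K] V →ₗ[K] K) :
    V × W →ₗ[K] Module.Dual K W × Module.Dual K V :=
  (a.coprod s).prod ((-t).coprod a.flip)

lemma primalDualMap_bijective [FiniteDimensional K V] [FiniteDimensional K W]
    {a : V →ₗ[K] W →ₗ[K] K} {s : W →ₗ[K] W →ₗ[K] K} {t : V →ₗ[K] V →ₗ[K] K}
    (hinj : Function.Injective (primalDualMap a s t)) :
    Function.Bijective (primalDualMap a s t) := by
  refine ⟨hinj, (LinearMap.injective_iff_surjective_of_finrank_eq_finrank ?_).1 hinj⟩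
  rw [Module.finrank_prod, Module.finrank_prod, Subspace.dual_finrank_eq,
    Subspace.dual_finrank_eq, add_comm]

end PrimalDualMap

lemma totalDegree_aeval_le {σ τ R : Type*} [CommSemiring R] {g : σ → MvPolynomial τ R} {n : ℕ}
    (hg : ∀ i, (g i).totalDegree ≤ n) (p : MvPolynomial σ R) :
    (MvPolynomial.aeval g p).totalDegree ≤ n * p.totalDegree := by
  rw [MvPolynomial.aeval_def, MvPolynomial.eval₂_eq]
  refine MvPolynomial.totalDegree_finsetSum_le fun s hs => ?_
  calc _ ≤ (∏ i ∈ s.support, g i ^ s i).totalDegree := by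
        simpa [MvPolynomial.algebraMap_eq] using
          MvPolynomial.totalDegree_mul (MvPolynomial.C (p.coeff s)) (∏ i ∈ s.support, g i ^ s i)
    _ ≤ ∑ i ∈ s.support, (g i ^ s i).totalDegree := MvPolynomial.totalDegree_finsetProd _ _
    _ ≤ ∑ i ∈ s.support, n * s i := Finset.sum_le_sum fun i _ =>
        (MvPolynomial.totalDegree_pow _ _).trans ((Nat.mul_le_mul_left _ (hg i)).trans_eq
          (mul_comm _ _))
    _ = n * s.sum fun _ e => e := (Finset.mul_sum _ _ _).symm
    _ ≤ n * p.totalDegree := Nat.mul_le_mul_left n (MvPolynomial.le_totalDegree hs)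

section Polynomials

variable {d : ℕ}

/-- The algebra morphism sending a polynomial to the function it defines on `E d`. -/
noncomputable def polyFun : MvPolynomial (Fin d) ℝ →ₐ[ℝ] E d → ℝ :=
  MvPolynomial.aeval fun i x => x i

lemma polyFun_apply (p : MvPolynomial (Fin d) ℝ) (x : E d) :
    polyFun p x = MvPolynomial.eval (fun i => x i) p := by
  have h : (Pi.evalAlgHom ℝ (fun _ : E d => ℝ) x).comp polyFun =
      MvPolynomial.aeval fun i => x i := by
    ext i
    simp [polyFun]
  exact (DFunLike.congr_fun h p).trans (by rw [MvPolynomial.aeval_eq_eval])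

lemma contDiff_polyFun {n : WithTop ℕ∞} (p : MvPolynomial (Fin d) ℝ) :
    ContDiff ℝ n (polyFun p) := by
  rw [funext (polyFun_apply p)]
  exact (AnalyticOnNhd.eval_continuousLinearMap'
    (fun i => (EuclideanSpace.proj i : E d →L[ℝ] ℝ)) p).contDiff

lemma fderiv_polyFun_single (p : MvPolynomial (Fin d) ℝ) (i : Fin d) (x : E d) :
    fderiv ℝ (polyFun p) x (EuclideanSpace.single i 1) = polyFun (MvPolynomial.pderiv i p) x := by
  have hdiff (q : MvPolynomial (Fin d) ℝ) : DifferentiableAt ℝ (polyFun q) x :=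
    (contDiff_polyFun (n := 1) q).differentiable one_ne_zero x
  induction p using MvPolynomial.induction_on with
  | C a =>
    have hC : polyFun (MvPolynomial.C a) = fun _ : E d => a := by ext y; simp [polyFun_apply]
    simp [hC]
  | add p q hp hq => simp [fderiv_add (hdiff p) (hdiff q), hp, hq]
  | mul_X p j hp =>
    have hX : polyFun (MvPolynomial.X j) = (EuclideanSpace.proj j : E d →L[ℝ] ℝ) := by
      ext y; simp [polyFun_apply]
    rw [map_mul, fderiv_mul (hdiff p) (hdiff _), MvPolynomial.pderiv_mul, map_add, map_mul, map_mul]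
    simp only [_root_.add_apply, _root_.smul_apply, hp, hX, ContinuousLinearMap.fderiv]
    rcases eq_or_ne j i with rfl | hji
    · simp [add_comm, mul_comm]
    · simp [MvPolynomial.pderiv_X_of_ne hji, hji, mul_comm]

lemma eq_zero_of_polyFun_ae_eq_zero {p : MvPolynomial (Fin d) ℝ} {x : E d} {r : ℝ}
    (hr : 0 < r) (h : polyFun p =ᵐ[volume.restrict (Metric.ball x r)] 0) : p = 0 := by
  have hball : Set.EqOn (polyFun p) 0 (Metric.ball x r) :=
    Measure.eqOn_open_of_ae_eq h Metric.isOpen_ball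
      (contDiff_polyFun (n := 0) p).continuous.continuousOn continuousOn_const
  have hopen : IsOpen ((WithLp.toLp 2 : (Fin d → ℝ) → E d) ⁻¹' Metric.ball x r) :=
    Metric.isOpen_ball.preimage (PiLp.continuous_toLp 2 _)
  obtain ⟨δ, hδ, hsub⟩ := Metric.isOpen_iff.1 hopen (WithLp.ofLp x) (by simpa using hr)
  refine MvPolynomial.funext_set (fun i => Metric.ball (x i) δ) (fun i => ?_) fun y hy => ?_
  · rw [Real.ball_eq_Ioo]
    exact Set.Ioo_infinite (by linarith)
  · rw [ball_pi _ hδ] at hsub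
    simpa [polyFun_apply] using hball (hsub hy)

/-- The pullback `p ↦ p(x + r ·)` of polynomials under a dilation. -/
noncomputable def affinePullback (x : E d) (r : ℝ) :
    MvPolynomial (Fin d) ℝ →ₐ[ℝ] MvPolynomial (Fin d) ℝ :=
  MvPolynomial.aeval fun i => MvPolynomial.C (x i) + MvPolynomial.C r * MvPolynomial.X i

lemma polyFun_affinePullback (x : E d) (r : ℝ) (p : MvPolynomial (Fin d) ℝ) (y : E d) :
    polyFun (affinePullback x r p) y = polyFun p (x + r • y) := by
  induction p using MvPolynomial.induction_on with
  | C a => simp [affinePullback, polyFun_apply]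
  | add p q hp hq => simp [hp, hq]
  | mul_X p i hp =>
    simp only [map_mul, Pi.mul_apply, hp]
    simp [affinePullback, polyFun_apply]

lemma totalDegree_affinePullback_le (x : E d) (r : ℝ) (p : MvPolynomial (Fin d) ℝ) :
    (affinePullback x r p).totalDegree ≤ p.totalDegree :=
  have hlinear (i : Fin d) :
      (MvPolynomial.C (x i) + MvPolynomial.C r * MvPolynomial.X i).totalDegree ≤ 1 :=
    (MvPolynomial.totalDegree_add _ _).trans
      (max_le (by simp) ((MvPolynomial.totalDegree_mul _ _).trans (by simp)))
  (totalDegree_aeval_le hlinear p).trans_eq (one_mul _)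

lemma pderiv_affinePullback (x : E d) (r : ℝ) (i : Fin d) (p : MvPolynomial (Fin d) ℝ) :
    MvPolynomial.pderiv i (affinePullback x r p) =
      r • affinePullback x r (MvPolynomial.pderiv i p) := by
  induction p using MvPolynomial.induction_on with
  | C a => simp [affinePullback]
  | add p q hp hq => simp [hp, hq]
  | mul_X p j hp =>
    rw [map_mul, MvPolynomial.pderiv_mul, hp, MvPolynomial.pderiv_mul, map_add, map_mul, map_mul]
    rcases eq_or_ne j i with rfl | hji
    · simp [affinePullback, MvPolynomial.smul_eq_C_mul]
      ring
    · simp [affinePullback, MvPolynomial.smul_eq_C_mul, MvPolynomial.pderiv_X_of_ne hji]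
      ring

lemma memLp_polyFun (μ : Measure (E d)) [IsFiniteMeasureOnCompacts μ] {U : Set (E d)}
    (hU : Bornology.IsBounded U) (p : MvPolynomial (Fin d) ℝ) :
    MemLp (polyFun p) 2 (μ.restrict U) :=
  memLp_restrict_of_continuous_of_isBounded (contDiff_polyFun (n := 0) p).continuous hU 2

/-- The class in `L²(U, μ)` of a polynomial function, for a bounded set `U`. -/
noncomputable def polyL2 (μ : Measure (E d)) [IsFiniteMeasureOnCompacts μ] {U : Set (E d)}
    (hU : Bornology.IsBounded U) : MvPolynomial (Fin d) ℝ →ₗ[ℝ] Lp ℝ 2 (μ.restrict U) where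
  toFun p := (memLp_polyFun μ hU p).toLp (polyFun p)
  map_add' p q := by simp only [map_add]; exact MemLp.toLp_add _ _
  map_smul' c p := by simp only [map_smul]; exact MemLp.toLp_const_smul c _

lemma norm_polyL2_sq (μ : Measure (E d)) [IsFiniteMeasureOnCompacts μ] {U : Set (E d)}
    (hU : Bornology.IsBounded U) (p : MvPolynomial (Fin d) ℝ) :
    ‖polyL2 μ hU p‖ ^ 2 = ∫ y in U, polyFun p y ^ 2 ∂μ :=
  norm_toLp_sq (memLp_polyFun μ hU p)

lemma polyL2_injective {U : Set (E d)} (hU : Bornology.IsBounded U) {x : E d} {r : ℝ} (hr : 0 < r)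
    (hball : Metric.ball x r ⊆ U) : Function.Injective (polyL2 volume hU) := by
  rw [← LinearMap.ker_eq_bot, LinearMap.ker_eq_bot']
  intro p hp
  have hzero : polyFun p =ᵐ[volume.restrict U] 0 :=
    (memLp_polyFun volume hU p).coeFn_toLp.symm.trans ((Lp.eq_zero_iff_ae_eq_zero).1 hp)
  exact eq_zero_of_polyFun_ae_eq_zero hr (ae_mono (Measure.restrict_mono hball le_rfl) hzero)

lemma setIntegral_polyFun_sq_mono (p : MvPolynomial (Fin d) ℝ) {U U' : Set (E d)}
    (hU' : Bornology.IsBounded U') (h : U ⊆ U') :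
    ∫ y in U, polyFun p y ^ 2 ≤ ∫ y in U', polyFun p y ^ 2 :=
  setIntegral_mono_set (memLp_polyFun volume hU' p).integrable_sq
    (.of_forall fun _ => sq_nonneg _) h.eventuallyLE

lemma exists_setIntegral_pderiv_sq_le_unit (d k : ℕ) (σ : ℝ) :
    ∃ C : ℝ, 0 ≤ C ∧ ∀ p : MvPolynomial (Fin d) ℝ, p.totalDegree ≤ k → ∀ i, ∀ U : Set (E d),
      Metric.ball 0 1 ⊆ U → U ⊆ Metric.closedBall 0 σ →
      ∫ y in U, polyFun (MvPolynomial.pderiv i p) y ^ 2 ≤ C * ∫ y in U, polyFun p y ^ 2 := by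
  have hball : Bornology.IsBounded (Metric.ball (0 : E d) 1) := Metric.isBounded_ball
  have hclosedBall : Bornology.IsBounded (Metric.closedBall (0 : E d) σ) :=
    Metric.isBounded_closedBall
  let F := MvPolynomial.restrictTotalDegree (Fin d) ℝ k
  let gradient : F →ₗ[ℝ] Fin d → L2 (Metric.closedBall (0 : E d) σ) := LinearMap.pi fun i =>
    polyL2 volume hclosedBall ∘ₗ (MvPolynomial.pderiv i).toLinearMap ∘ₗ F.subtype
  obtain ⟨C, -, hbound⟩ := exists_norm_le_mul_norm_of_injective
    (S := polyL2 volume hball ∘ₗ F.subtype)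
    ((polyL2_injective hball one_pos subset_rfl).comp F.injective_subtype) gradient
  refine ⟨C ^ 2, sq_nonneg C, fun p hp i U hU hUσ => ?_⟩
  have hpF : p ∈ F := (MvPolynomial.mem_restrictTotalDegree _ _ _).2 hp
  have hnorm : ‖polyL2 volume hclosedBall (MvPolynomial.pderiv i p)‖ ≤
      C * ‖polyL2 volume hball p‖ :=
    (norm_le_pi_norm (gradient ⟨p, hpF⟩) i).trans (hbound ⟨p, hpF⟩)
  calc ∫ y in U, polyFun (MvPolynomial.pderiv i p) y ^ 2
    _ ≤ ∫ y in Metric.closedBall 0 σ, polyFun (MvPolynomial.pderiv i p) y ^ 2 :=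
      setIntegral_polyFun_sq_mono _ hclosedBall hUσ
    _ = ‖polyL2 volume hclosedBall (MvPolynomial.pderiv i p)‖ ^ 2 := (norm_polyL2_sq _ _ _).symm
    _ ≤ C ^ 2 * ‖polyL2 volume hball p‖ ^ 2 := by rw [← mul_pow]; gcongr
    _ = C ^ 2 * ∫ y in Metric.ball 0 1, polyFun p y ^ 2 := by rw [norm_polyL2_sq]
    _ ≤ C ^ 2 * ∫ y in U, polyFun p y ^ 2 := mul_le_mul_of_nonneg_left
      (setIntegral_polyFun_sq_mono _ (hclosedBall.subset hUσ) hU) (sq_nonneg C)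

lemma exists_setIntegral_pderiv_sq_le (d k : ℕ) (σ : ℝ) :
    ∃ C : ℝ, 0 ≤ C ∧ ∀ p : MvPolynomial (Fin d) ℝ, p.totalDegree ≤ k →
      ∀ i, ∀ (U : Set (E d)) (x : E d) (r : ℝ), 0 < r → Metric.ball x r ⊆ U →
        U ⊆ Metric.closedBall x (σ * r) →
      r ^ 2 * ∫ y in U, polyFun (MvPolynomial.pderiv i p) y ^ 2 ≤
        C * ∫ y in U, polyFun p y ^ 2 := by
  obtain ⟨C, hC, hunit⟩ := exists_setIntegral_pderiv_sq_le_unit d k σ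
  refine ⟨C, hC, fun p hp i U x r hr hball hclosedBall => ?_⟩
  have hscaled := hunit (affinePullback x r p) ((totalDegree_affinePullback_le x r p).trans hp) i
    ((fun y => x + r • y) ⁻¹' U)
    (fun y hy => hball (by
      simpa [norm_smul, abs_of_pos hr] using mul_lt_of_lt_one_right hr (mem_ball_zero_iff.1 hy)))
    (fun y hy => by simpa [norm_smul, abs_of_pos hr, mul_comm r, hr] using hclosedBall hy)
  simp only [pderiv_affinePullback, map_smul, Pi.smul_apply, smul_eq_mul, mul_pow,
    polyFun_affinePullback, integral_const_mul] at hscaled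
  rw [setIntegral_comp_add_smul volume (fun y => polyFun (MvPolynomial.pderiv i p) y ^ 2) U x hr,
    setIntegral_comp_add_smul volume (fun y => polyFun p y ^ 2) U x hr, smul_eq_mul, smul_eq_mul,
    mul_left_comm, mul_left_comm C] at hscaled
  exact le_of_mul_le_mul_left hscaled (by positivity)

end Polynomials

section WeakDerivatives

variable {d m : ℕ} {U U' : Set (E d)} {i : Fin m → Fin d} {φ v g k : E d → ℝ} {x : E d}

lemma IsTest.eventuallyEq_zero (hφ : IsTest U φ) (hx : x ∉ U) : φ =ᶠ[nhds x] 0 :=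
  notMem_tsupport_iff_eventuallyEq.1 fun hx' => hx (hφ.support hx')

lemma IsTest.partialDeriv_eq_zero (hφ : IsTest U φ) (hx : x ∉ U) (i : Fin m → Fin d) :
    partialDeriv i φ x = 0 := by
  rw [partialDeriv, ((hφ.eventuallyEq_zero hx).iteratedFDeriv ℝ m).self_of_nhds]
  simp

lemma HasWeakDeriv.ae_eq (hU : IsOpen U) (hg : HasWeakDeriv U i v g) (hk : HasWeakDeriv U i v k) :
    g =ᵐ[volume.restrict U] k := by
  have hloc : LocallyIntegrableOn (g - k) U volume :=
    locallyIntegrableOn_of_locallyIntegrable_restrict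
      ((hg.1.sub hk.1).locallyIntegrable one_le_two)
  have hzero : ∀ᵐ x ∂volume, x ∈ U → (g - k) x = 0 := by
    refine hU.ae_eq_zero_of_integral_contDiff_smul_eq_zero hloc fun φ hsmooth hcompact hsupp => ?_
    have hφ : IsTest U φ := ⟨hsmooth, hcompact, hsupp⟩
    have htest : ∫ x in U, g x * φ x = ∫ x in U, k x * φ x :=
      mul_left_cancel₀ (pow_ne_zero m (by norm_num)) ((hg.2 φ hφ).symm.trans (hk.2 φ hφ))
    rw [← setIntegral_eq_integral_of_forall_compl_eq_zero fun x hx => by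
      rw [(hφ.eventuallyEq_zero hx).self_of_nhds, Pi.zero_apply, zero_smul]]
    calc ∫ x in U, φ x • (g - k) x = ∫ x in U, (g x * φ x - k x * φ x) := by
          simp only [Pi.sub_apply, smul_eq_mul, mul_sub, mul_comm]
      _ = (∫ x in U, g x * φ x) - ∫ x in U, k x * φ x :=
          integral_sub (hg.1.integrable_mul (test_memLp U hφ))
            (hk.1.integrable_mul (test_memLp U hφ))
      _ = 0 := sub_eq_zero.2 htest
  rw [Filter.EventuallyEq, ae_restrict_iff' hU.measurableSet]
  exact hzero.mono fun x hx hxU => sub_eq_zero.1 (hx hxU)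

lemma HasWeakDeriv.weakDeriv_ae_eq (hU : IsOpen U) (hg : HasWeakDeriv U i v g) :
    weakDeriv U i v =ᵐ[volume.restrict U] g := by
  have hexists : ∃ g, HasWeakDeriv U i v g := ⟨g, hg⟩
  rw [weakDeriv, dif_pos hexists]
  exact hexists.choose_spec.ae_eq hU hg

lemma HasWeakDeriv.restrict (hU : MeasurableSet U) (h : U' ⊆ U) (hg : HasWeakDeriv U i v g) :
    HasWeakDeriv U' i v g := by
  refine ⟨hg.1.mono_measure (Measure.restrict_mono h le_rfl), fun φ hφ => ?_⟩
  have hU' := hg.2 φ ⟨hφ.smooth, hφ.compact, hφ.support.trans h⟩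
  rwa [setIntegral_eq_of_subset_of_forall_sdiff_eq_zero hU h fun x hx => by
      rw [hφ.partialDeriv_eq_zero hx.2, mul_zero],
    setIntegral_eq_of_subset_of_forall_sdiff_eq_zero hU h fun x hx => by
      rw [(hφ.eventuallyEq_zero hx.2).self_of_nhds, Pi.zero_apply, mul_zero]] at hU'

lemma hasWeakDeriv_of_contDiff (hU : Bornology.IsBounded U) (hv : ContDiff ℝ 1 v)
    (i : Fin 1 → Fin d) :
    HasWeakDeriv U i v fun x => fderiv ℝ v x (EuclideanSpace.single (i 0) 1) := by
  have hv' : Continuous fun x => fderiv ℝ v x (EuclideanSpace.single (i 0) 1) :=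
    (hv.continuous_fderiv one_ne_zero).clm_apply continuous_const
  refine ⟨memLp_restrict_of_continuous_of_isBounded hv' hU 2, fun φ hφ => ?_⟩
  have hφ' : Continuous fun x => fderiv ℝ φ x (EuclideanSpace.single (i 0) 1) :=
    (hφ.smooth.continuous_fderiv (by simp)).clm_apply continuous_const
  rw [setIntegral_eq_integral_of_forall_compl_eq_zero fun x hx => by
      rw [hφ.partialDeriv_eq_zero hx, mul_zero],
    setIntegral_eq_integral_of_forall_compl_eq_zero fun x hx => by
      rw [(hφ.eventuallyEq_zero hx).self_of_nhds, Pi.zero_apply, mul_zero]]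
  simp only [partialDeriv, iteratedFDeriv_one_apply, pow_one, neg_one_mul]
  exact integral_mul_fderiv_eq_neg_fderiv_mul_of_integrable
    ((hv'.mul hφ.smooth.continuous).integrable_of_hasCompactSupport hφ.compact.mul_left)
    ((hv.continuous.mul hφ').integrable_of_hasCompactSupport
      (hφ.compact.fderiv_apply ℝ _).mul_left)
    ((hv.continuous.mul hφ.smooth.continuous).integrable_of_hasCompactSupport hφ.compact.mul_left)
    (fun x _ => hv.differentiable one_ne_zero x)
    fun x _ => hφ.smooth.differentiable (by simp) x

lemma hasWeakDeriv_polyFun (hU : Bornology.IsBounded U) (i : Fin 1 → Fin d)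
    (p : MvPolynomial (Fin d) ℝ) :
    HasWeakDeriv U i (polyFun p) (polyFun (MvPolynomial.pderiv (i 0) p)) := by
  simpa only [fderiv_polyFun_single] using hasWeakDeriv_of_contDiff hU (contDiff_polyFun p) i

lemma hSeminorm_nonneg (U : Set (E d)) (m : ℕ) (v : E d → ℝ) : 0 ≤ hSeminorm U m v :=
  Real.sqrt_nonneg _

lemma hSeminorm_sq (U : Set (E d)) (m : ℕ) (v : E d → ℝ) :
    hSeminorm U m v ^ 2 = ∑ i : Fin m → Fin d, ∫ x in U, weakDeriv U i v x ^ 2 :=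
  Real.sq_sqrt (Finset.sum_nonneg fun _ _ => integral_nonneg fun _ => sq_nonneg _)

lemma hSeminorm_eq_norm (hU : IsOpen U) {g : (Fin m → Fin d) → E d → ℝ}
    (hg : ∀ i, HasWeakDeriv U i v (g i)) :
    hSeminorm U m v = ‖WithLp.toLp 2 fun i => (hg i).1.toLp (g i)‖ := by
  rw [hSeminorm, PiLp.norm_eq_of_L2]
  congr 1
  refine Finset.sum_congr rfl fun i _ => ?_
  rw [norm_toLp_sq, integral_sq_congr_ae ((hg i).weakDeriv_ae_eq hU)]

lemma hSeminorm_add_le (hU : IsOpen U) {v w : L2 U} (hv : v ∈ H U m) (hw : w ∈ H U m) :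
    hSeminorm U m (v + w : L2 U) ≤ hSeminorm U m v + hSeminorm U m w := by
  choose g hg using hv m le_rfl
  choose k hk using hw m le_rfl
  have hgk (i : Fin m → Fin d) : HasWeakDeriv U i (v + w : L2 U) (g i + k i) :=
    ((hg i).add (Lp.memLp v) (Lp.memLp w) (hk i)).congr (Lp.coeFn_add v w).symm
  rw [hSeminorm_eq_norm hU hg, hSeminorm_eq_norm hU hk, hSeminorm_eq_norm hU hgk]
  exact norm_add_le (WithLp.toLp 2 fun i => (hg i).1.toLp (g i))
    (WithLp.toLp 2 fun i => (hk i).1.toLp (k i))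

end WeakDerivatives

section Triangulations

variable {d : ℕ}

/-- The open simplex with vertices `K`, as a set of points. -/
abbrev openElement (K : Finset (E d)) : Set (E d) := interior (convexHull ℝ (K : Set (E d)))

lemma isBounded_element (K : Finset (E d)) : Bornology.IsBounded (convexHull ℝ (K : Set (E d))) :=
  isBounded_convexHull.2 K.finite_toSet.isBounded

lemma isBounded_openElement (K : Finset (E d)) : Bornology.IsBounded (openElement K) :=
  (isBounded_element K).subset interior_subset

lemma meshSize_nonneg (T : SimplicialComplex ℝ (E d)) : 0 ≤ meshSize T :=
  Real.sSup_nonneg (by rintro _ ⟨K, -, rfl⟩; exact Metric.diam_nonneg)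

lemma disjoint_openElement {T : SimplicialComplex ℝ (E d)} {K K' : Finset (E d)}
    (hK : K ∈ elements T) (hK' : K' ∈ elements T) (hne : K ≠ K') :
    Disjoint (openElement K) (openElement K') := by
  obtain ⟨p, hpK, hpK'⟩ : ∃ p ∈ K, p ∉ K' := by
    by_contra! h
    exact hne (Finset.eq_of_subset_of_card_le h (by rw [hK.2, hK'.2]))
  rw [Set.disjoint_iff_inter_eq_empty]
  by_contra! hnonempty
  have hsub : openElement K ∩ openElement K' ⊆ affineSpan ℝ ((K : Set (E d)) ∩ K') :=
    (Set.inter_subset_inter interior_subset interior_subset).trans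
      ((T.inter_subset_convexHull hK.1 hK'.1).trans (convexHull_subset_affineSpan _))
  have htop : affineSpan ℝ ((K : Set (E d)) ∩ K') = ⊤ := by
    rw [eq_top_iff, ← (isOpen_interior.inter isOpen_interior).affineSpan_eq_top hnonempty]
    exact affineSpan_le.2 hsub
  refine (T.indep hK.1).notMem_affineSpan_sdiff ⟨p, hpK⟩ Set.univ
    (affineSpan_mono ℝ ?_ (htop ▸ AffineSubspace.mem_top ℝ (E d) p))
  rintro x ⟨hxK, hxK'⟩
  have hxp : x ≠ p := fun h => hpK' (h ▸ hxK')
  exact ⟨⟨x, hxK⟩, ⟨Set.mem_univ _, fun h => hxp (congrArg Subtype.val h)⟩, rfl⟩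

namespace IsTriangulation

variable {Ω : Set (E d)} {T : SimplicialComplex ℝ (E d)} (hT : IsTriangulation Ω T)
include hT

lemma isOpen : IsOpen Ω := hT.covers ▸ isOpen_interior

lemma finite_elements : (elements T).Finite := hT.finite.subset fun _ h => h.1

lemma openElement_subset {K : Finset (E d)} (hK : K ∈ elements T) : openElement K ⊆ Ω := by
  rw [← hT.covers]
  exact interior_mono (Set.subset_biUnion_of_mem (u := fun K : Finset (E d) =>
    convexHull ℝ (K : Set (E d))) hK)

lemma biUnion_openElement_ae_eq : (⋃ K ∈ elements T, openElement K) =ᵐ[volume] Ω := by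
  have hsub : ⋃ K ∈ elements T, openElement K ⊆ Ω :=
    Set.iUnion₂_subset fun K hK => hT.openElement_subset hK
  have hdiff : Ω \ ⋃ K ∈ elements T, openElement K ⊆
      ⋃ K ∈ elements T, frontier (convexHull ℝ (K : Set (E d))) := by
    rintro x ⟨hx, hx'⟩
    rw [← hT.covers] at hx
    obtain ⟨K, hK, hxK⟩ := Set.mem_iUnion₂.1 (interior_subset hx)
    exact Set.mem_iUnion₂.2
      ⟨K, hK, subset_closure hxK, fun h => hx' (Set.mem_iUnion₂.2 ⟨K, hK, h⟩)⟩
  have hnull : volume (⋃ K ∈ elements T, frontier (convexHull ℝ (K : Set (E d)))) = 0 :=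
    (measure_biUnion_null_iff hT.finite_elements.countable).2 fun K _ =>
      (convex_convexHull ℝ _).addHaar_frontier volume
  exact hsub.eventuallyLE.antisymm (ae_le_set.2 (measure_mono_null hdiff hnull))

lemma ae_eq_of_forall_openElement {α : Type*} {f g : E d → α}
    (h : ∀ K ∈ elements T, f =ᵐ[volume.restrict (openElement K)] g) :
    f =ᵐ[volume.restrict Ω] g := by
  rw [← Measure.restrict_congr_set hT.biUnion_openElement_ae_eq]
  exact (ae_restrict_biUnion_iff _ hT.finite_elements.countable _).2 h

lemma setIntegral_eq_sum {f : E d → ℝ} (hf : IntegrableOn f Ω) :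
    ∫ x in Ω, f x = ∑ K ∈ hT.finite_elements.toFinset, ∫ x in openElement K, f x := by
  have hbiUnion : (⋃ K ∈ hT.finite_elements.toFinset, openElement K) =ᵐ[volume] Ω := by
    simpa only [Set.Finite.mem_toFinset] using hT.biUnion_openElement_ae_eq
  have helement {K : Finset (E d)} (hK : K ∈ hT.finite_elements.toFinset) : K ∈ elements T :=
    hT.finite_elements.mem_toFinset.1 hK
  rw [← setIntegral_congr_set hbiUnion]
  exact integral_biUnion_finset _ (fun _ _ => isOpen_interior.measurableSet)
    (fun _ hK _ hK' hne => disjoint_openElement (helement hK) (helement hK') hne)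
    fun _ hK => hf.mono_set (hT.openElement_subset (helement hK))

end IsTriangulation

end Triangulations

section FiniteElements

variable {d k : ℕ} {Ω : Set (E d)} {T : SimplicialComplex ℝ (E d)} {K : Finset (E d)}

lemma weakDeriv_ae_eq_polyFun_pderiv (hΩ : IsOpen Ω) (hK : openElement K ⊆ Ω) {v : L2 Ω}
    (hv : v ∈ H Ω 1) {p : MvPolynomial (Fin d) ℝ}
    (hvp : v =ᵐ[volume.restrict (openElement K)] polyFun p) (i : Fin 1 → Fin d) :
    weakDeriv Ω i v =ᵐ[volume.restrict (openElement K)]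
      polyFun (MvPolynomial.pderiv (i 0) p) := by
  obtain ⟨g, hg⟩ := hv 1 le_rfl i
  have hweak : weakDeriv Ω i v =ᵐ[volume.restrict (openElement K)] g :=
    ae_mono (Measure.restrict_mono hK le_rfl) (hg.weakDeriv_ae_eq hΩ)
  exact hweak.trans ((hg.restrict hΩ.measurableSet hK).ae_eq isOpen_interior
    ((hasWeakDeriv_polyFun (isBounded_openElement K) i p).congr hvp.symm))

lemma exists_element_inverseInequality (d k : ℕ) (σ : ℝ) :
    ∃ C : ℝ, 0 ≤ C ∧ ∀ {Ω : Set (E d)} {K : Finset (E d)} {x : E d} {r : ℝ},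
      IsOpen Ω → openElement K ⊆ Ω → 0 < r →
      Metric.closedBall x r ⊆ convexHull ℝ (K : Set (E d)) → elementDiam K ≤ σ * r →
      ∀ v : L2 Ω, v ∈ H Ω 1 → IsPolyOn k K v → ∀ i : Fin 1 → Fin d,
        r ^ 2 * ∫ y in openElement K, weakDeriv Ω i v y ^ 2 ≤
          C * ∫ y in openElement K, v y ^ 2 := by
  obtain ⟨C, hC, hpoly⟩ := exists_setIntegral_pderiv_sq_le d k σ
  refine ⟨C, hC, fun {Ω K x r} hΩ hK hr hball hdiam v hv ⟨p, hp, hvp⟩ i => ?_⟩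
  replace hvp : v =ᵐ[volume.restrict (openElement K)] polyFun p := by
    simpa only [funext (polyFun_apply p)] using hvp
  rw [integral_sq_congr_ae (weakDeriv_ae_eq_polyFun_pderiv hΩ hK hv hvp i),
    integral_sq_congr_ae hvp]
  have hopenBall : Metric.ball x r ⊆ openElement K :=
    interior_maximal (Metric.ball_subset_closedBall.trans hball) Metric.isOpen_ball
  have hclosedBall : openElement K ⊆ Metric.closedBall x (σ * r) := fun y hy =>
    (Metric.dist_le_diam_of_mem (isBounded_element K) (interior_subset hy)
      (hball (Metric.mem_closedBall_self hr.le))).trans hdiam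
  exact hpoly p hp (i 0) _ x r hr hopenBall hclosedBall

lemma exists_meshSize_inverseInequality (d k : ℕ) {σ τ : ℝ} (hσ : 0 ≤ σ) (hτ : 0 ≤ τ) :
    ∃ C : ℝ, 0 ≤ C ∧ ∀ {Ω : Set (E d)} {T : SimplicialComplex ℝ (E d)}, IsTriangulation Ω T →
      ShapeRegular T σ → QuasiUniform T τ → ∀ v : L2 Ω, IsFEFunction T k v →
      ∀ K ∈ elements T, ∀ i : Fin 1 → Fin d,
        meshSize T ^ 2 * ∫ y in openElement K, weakDeriv Ω i v y ^ 2 ≤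
          C * ∫ y in openElement K, v y ^ 2 := by
  obtain ⟨C, hC, helement⟩ := exists_element_inverseInequality d k σ
  refine ⟨(τ * σ) ^ 2 * C, by positivity, fun {Ω T} hT hs hq v hv K hK i => ?_⟩
  obtain ⟨x, r, hball, hdiam⟩ := hs K hK
  have hmesh : meshSize T ≤ τ * σ * r := by
    rw [mul_assoc]
    exact (hq K hK).trans (mul_le_mul_of_nonneg_left hdiam hτ)
  have hmesh_nonneg := meshSize_nonneg T
  have hgrad : 0 ≤ ∫ y in openElement K, weakDeriv Ω i v y ^ 2 :=
    integral_nonneg fun _ => sq_nonneg _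
  rcases le_or_gt r 0 with hr | hr
  · have hmesh_zero : meshSize T = 0 :=
      le_antisymm (hmesh.trans (mul_nonpos_of_nonneg_of_nonpos (by positivity) hr)) hmesh_nonneg
    rw [hmesh_zero, zero_pow two_ne_zero, zero_mul]
    exact mul_nonneg (by positivity) (integral_nonneg fun _ => sq_nonneg _)
  · calc _ ≤ (τ * σ * r) ^ 2 * ∫ y in openElement K, weakDeriv Ω i v y ^ 2 :=
          mul_le_mul_of_nonneg_right (by gcongr) hgrad
      _ = (τ * σ) ^ 2 * (r ^ 2 * ∫ y in openElement K, weakDeriv Ω i v y ^ 2) := by ring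
      _ ≤ (τ * σ) ^ 2 * (C * ∫ y in openElement K, v y ^ 2) := mul_le_mul_of_nonneg_left
          (helement hT.isOpen (hT.openElement_subset hK) hr hball hdiam v hv.1 (hv.2 K hK) i)
          (sq_nonneg _)
      _ = _ := by ring

/-- The inverse inequality `h ‖∇v‖ ≤ c ‖v‖` for the finite element functions of degree `k` on a
triangulation `T` of `Ω`. -/
def InverseInequality (Ω : Set (E d)) (T : SimplicialComplex ℝ (E d)) (k : ℕ) (c : ℝ) : Prop :=
  ∀ v : L2 Ω, IsFEFunction T k v → meshSize T * hSeminorm Ω 1 v ≤ c * ‖v‖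

lemma exists_inverseInequality (d k : ℕ) {σ τ : ℝ} (hσ : 0 ≤ σ) (hτ : 0 ≤ τ) :
    ∃ c : ℝ, 0 ≤ c ∧ ∀ {Ω : Set (E d)} {T : SimplicialComplex ℝ (E d)}, IsTriangulation Ω T →
      ShapeRegular T σ → QuasiUniform T τ → InverseInequality Ω T k c := by
  obtain ⟨C, hC, helement⟩ := exists_meshSize_inverseInequality d k hσ hτ
  refine ⟨√(Fintype.card (Fin 1 → Fin d) * C), Real.sqrt_nonneg _,
    fun {Ω T} hT hs hq v hv => le_of_sq_le_sq ?_ (by positivity)⟩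
  have hpartial (i : Fin 1 → Fin d) :
      meshSize T ^ 2 * ∫ x in Ω, weakDeriv Ω i v x ^ 2 ≤ C * ‖v‖ ^ 2 := by
    obtain ⟨g, hg⟩ := hv.1 1 le_rfl i
    have hint : IntegrableOn (fun x => weakDeriv Ω i v x ^ 2) Ω :=
      hg.1.integrable_sq.congr
        ((hg.weakDeriv_ae_eq hT.isOpen).symm.mono fun x hx => congrArg (· ^ 2) hx)
    rw [norm_sq_eq_integral_sq, hT.setIntegral_eq_sum hint,
      hT.setIntegral_eq_sum (Lp.memLp v).integrable_sq, Finset.mul_sum, Finset.mul_sum]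
    exact Finset.sum_le_sum fun K hK =>
      helement hT hs hq v hv K (hT.finite_elements.mem_toFinset.1 hK) i
  rw [mul_pow, mul_pow, Real.sq_sqrt (by positivity), hSeminorm_sq, Finset.mul_sum, mul_assoc,
    ← nsmul_eq_mul]
  exact Finset.sum_le_card_nsmul _ _ _ fun i _ => hpartial i

lemma finiteDimensional_of_forall_isPolyOn (hT : IsTriangulation Ω T) {S : Submodule ℝ (L2 Ω)}
    (hS : ∀ v ∈ S, ∀ K ∈ elements T, IsPolyOn k K v) : FiniteDimensional ℝ S := by
  have : Finite (elements T) := hT.finite_elements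
  let R (K : elements T) : Submodule ℝ (Lp ℝ 2 ((volume.restrict Ω).restrict (openElement K.1))) :=
    (MvPolynomial.restrictTotalDegree (Fin d) ℝ k).map
      (polyL2 (volume.restrict Ω) (isBounded_openElement K.1))
  let restr (K : elements T) :=
    LpToLpRestrictCLM (E d) ℝ ℝ (volume.restrict Ω) 2 (openElement K.1)
  have hae (K : elements T) (v : S) :
      restr K v =ᵐ[(volume.restrict Ω).restrict (openElement K.1)] v :=
    LpToLpRestrictCLM_coeFn ℝ _ _
  have hmeasure (K : elements T) : (volume.restrict Ω).restrict (openElement K.1) =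
      volume.restrict (openElement K.1) :=
    Measure.restrict_restrict_of_subset (hT.openElement_subset K.2)
  have hmem (K : elements T) (v : S) : restr K v ∈ R K := by
    obtain ⟨p, hp, hvp⟩ := hS v v.2 K K.2
    refine ⟨p, (MvPolynomial.mem_restrictTotalDegree _ _ _).2 hp, Lp.ext ?_⟩
    refine ((memLp_polyFun _ (isBounded_openElement K.1) p).coeFn_toLp).trans
      (Filter.EventuallyEq.trans ?_ (hae K v).symm)
    rw [hmeasure, funext (polyFun_apply p)]
    exact hvp.symm
  let f : S →ₗ[ℝ] ∀ K, R K := LinearMap.pi fun K =>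
    ((restr K).toLinearMap ∘ₗ S.subtype).codRestrict (R K) (hmem K)
  refine FiniteDimensional.of_injective f (LinearMap.ker_eq_bot.1 (LinearMap.ker_eq_bot'.2 ?_))
  intro v hv
  refine Subtype.ext (Lp.eq_zero_iff_ae_eq_zero.2 (hT.ae_eq_of_forall_openElement fun K hK => ?_))
  have hzero : restr ⟨K, hK⟩ v = 0 := congrArg Subtype.val (congrFun hv ⟨K, hK⟩)
  rw [← hmeasure ⟨K, hK⟩]
  exact (hae ⟨K, hK⟩ v).symm.trans (Lp.eq_zero_iff_ae_eq_zero.1 hzero)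

end FiniteElements

namespace Discretisation

variable {d k : ℕ} {Ω : Set (E d)} {P : Problem Ω} {T : SimplicialComplex ℝ (E d)}

section Seminorms

variable (D : Discretisation P T k)

lemma seminormP_nonneg (v : D.SV) : 0 ≤ D.seminormP v := Real.sqrt_nonneg _

lemma seminormA_nonneg (w : D.SW) : 0 ≤ D.seminormA w := Real.sqrt_nonneg _

lemma abs_sp_le (v w : D.SV) : |D.sp v w| ≤ D.seminormP v * D.seminormP w := by
  rw [seminormP, seminormP, ← Real.sqrt_mul (D.sp_nonneg v)]
  exact Real.abs_le_sqrt (LinearMap.BilinForm.apply_sq_le_of_symm D.sp D.sp_nonneg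
    ⟨D.sp_symm⟩ v w)

lemma abs_sa_le (v w : D.SW) : |D.sa v w| ≤ D.seminormA v * D.seminormA w := by
  rw [seminormA, seminormA, ← Real.sqrt_mul (D.sa_nonneg v)]
  exact Real.abs_le_sqrt (LinearMap.BilinForm.apply_sq_le_of_symm D.sa D.sa_nonneg
    ⟨D.sa_symm⟩ v w)

/-- The stabilisation seminorm `(|v|_{S_p}² + |w|_{S_a}²)^{1/2}` on pairs, in which the primal-dual
system is coercive. -/
noncomputable def stabNorm (v : D.SV) (w : D.SW) : ℝ := √(D.sp v v + D.sa w w)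

lemma stabNorm_nonneg (v : D.SV) (w : D.SW) : 0 ≤ D.stabNorm v w := Real.sqrt_nonneg _

lemma stabNorm_sq (v : D.SV) (w : D.SW) : D.stabNorm v w ^ 2 = D.sp v v + D.sa w w :=
  Real.sq_sqrt (add_nonneg (D.sp_nonneg v) (D.sa_nonneg w))

lemma seminormP_le_stabNorm (v : D.SV) (w : D.SW) : D.seminormP v ≤ D.stabNorm v w :=
  Real.sqrt_le_sqrt (le_add_of_nonneg_right (D.sa_nonneg w))

lemma seminormA_le_stabNorm (v : D.SV) (w : D.SW) : D.seminormA w ≤ D.stabNorm v w :=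
  Real.sqrt_le_sqrt (le_add_of_nonneg_left (D.sp_nonneg v))

/-- The interpolation error `v - π_V v`. -/
noncomputable abbrev interpErrorV (v : P.V) (hv : (v : L2 Ω) ∈ H Ω 2) : D.SV :=
  D.incV v hv - D.discV (D.piV v)

/-- The interpolation error `w - π_W w`. -/
noncomputable abbrev interpErrorW (w : P.W) (hw : (w : L2 Ω) ∈ H Ω 2) : D.SW :=
  D.incW w hw - D.discW (D.piW w)

/-- The distance `v_h - π_V v` of a discrete function to the interpolant of `v`. -/
noncomputable abbrev discError (v : P.V) (vh : D.Vh) : D.SV := D.discV vh - D.discV (D.piV v)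

/-- The seminorms of the interpolation error of `v` that govern the error of the method. -/
noncomputable def approxError (v : P.V) (hv : (v : L2 Ω) ∈ H Ω 2) : ℝ :=
  D.normL (D.interpErrorV v hv) + D.normPlus (D.interpErrorV v hv)
    + D.seminormP (D.interpErrorV v hv)

lemma approxError_nonneg (v : P.V) (hv : (v : L2 Ω) ∈ H Ω 2) : 0 ≤ D.approxError v hv :=
  add_nonneg (add_nonneg (apply_nonneg _ _) (apply_nonneg _ _)) (D.seminormP_nonneg _)

end Seminorms

variable {D : Discretisation P T k} {ca ci cΩ cγ ε : ℝ}

section Approximation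

lemma Approximation.normPlus_interpErrorV_le (happ : D.Approximation cγ) (v : P.V)
    (hv : (v : L2 Ω) ∈ H Ω 2) :
    D.normPlus (D.interpErrorV v hv) ≤ cγ * meshSize T * hSeminorm Ω 2 (v : L2 Ω) := by
  have happrox := happ.approx1 1 (.inl rfl) v hv hv
  have hL := apply_nonneg D.normL (D.interpErrorV v hv)
  have hP := D.seminormP_nonneg (D.interpErrorV v hv)
  rw [pow_one, one_add_one_eq_two] at happrox
  linarith

lemma Approximation.normStar_interpErrorW_le (happ : D.Approximation cγ) (w : P.W)
    (hw : (w : L2 Ω) ∈ H Ω 2) :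
    D.normStar (D.interpErrorW w hw) ≤ cγ * meshSize T * hSeminorm Ω 2 (w : L2 Ω) := by
  have happrox := happ.approx2 1 (.inl rfl) w hw hw
  have hA := D.seminormA_nonneg (D.interpErrorW w hw)
  rw [pow_one, one_add_one_eq_two] at happrox
  linarith

end Approximation

section Duality

variable {f : L2 Ω} {u : P.V} {hu : (u : L2 Ω) ∈ H Ω 2} {p : D.Vh × D.Wh}

lemma IsFEMSol.ah_forward (hp : D.IsFEMSol f u hu p) (hcons : D.Consistent)
    (hfu : P.IsForwardSol f u) (wh : D.Wh) :
    D.ah (D.incV u hu - D.discV p.1) (D.discW wh) = D.sa (D.discW p.2) (D.discW wh) := by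
  have hu_eq : D.ah (D.incV u hu) (D.discW wh) = inner ℝ f (wh : L2 Ω) :=
    hcons.forward f u hu hfu (D.discW wh)
  rw [map_sub, LinearMap.sub_apply, hu_eq, ← hp.1 wh]
  ring

lemma IsFEMSol.ah_adjoint (hp : D.IsFEMSol f u hu p) (vh : D.Vh) :
    D.ah (D.discV vh) (D.discW p.2) =
      D.sp (D.discError u p.1) (D.discV vh) - D.sp (D.interpErrorV u hu) (D.discV vh) := by
  have hadjoint := hp.2 vh
  simp only [map_sub, LinearMap.sub_apply]
  linarith

lemma IsFEMSol.stabNorm_sq_le (hp : D.IsFEMSol f u hu p) (hcons : D.Consistent)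
    (hcont : D.Continuity ca ε) (hfu : P.IsForwardSol f u) :
    D.stabNorm (D.discError u p.1) (D.discW p.2) ^ 2 ≤
      D.normPlus (D.interpErrorV u hu) * (ca * D.seminormA (D.discW p.2) + ε * ‖(p.2 : L2 Ω)‖)
        + D.seminormP (D.interpErrorV u hu) * D.seminormP (D.discError u p.1) := by
  have hforward := hp.ah_forward hcons hfu p.2
  have hadjoint := hp.ah_adjoint (p.1 - D.piV u)
  rw [show D.discV (p.1 - D.piV u) = D.discError u p.1 from rfl] at hadjoint
  calc D.stabNorm (D.discError u p.1) (D.discW p.2) ^ 2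
    _ = D.ah (D.incV u hu - D.discV p.1) (D.discW p.2)
          + D.ah (D.discError u p.1) (D.discW p.2)
          + D.sp (D.interpErrorV u hu) (D.discError u p.1) := by rw [stabNorm_sq]; linarith
    _ = D.ah (D.interpErrorV u hu) (D.discW p.2)
          + D.sp (D.interpErrorV u hu) (D.discError u p.1) := by
      rw [← LinearMap.add_apply, ← map_add, sub_add_sub_cancel]
    _ ≤ _ := add_le_add (hcont.cont1 u hu p.2) ((le_abs_self _).trans (D.abs_sp_le _ _))

-- Test the discrete adjoint equation with the interpolant of the forward solution with data `z_h`.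
lemma IsFEMSol.norm_dual_le (hp : D.IsFEMSol f u hu p) (hcΩ : 0 ≤ cΩ) (hcγ : 0 ≤ cγ)
    (hca : 0 ≤ ca) (hε : 0 ≤ ε) (hwp : P.WellPosed) (hsm : P.Smoothing cΩ) (hcons : D.Consistent)
    (hcont : D.Continuity ca ε) (happ : D.Approximation cγ) :
    ‖(p.2 : L2 Ω)‖ ≤ cγ * cΩ * meshSize T *
      (ca * D.seminormA (D.discW p.2) + D.seminormP (D.discError u p.1)
        + D.seminormP (D.interpErrorV u hu) + ε * ‖(p.2 : L2 Ω)‖) := by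
  obtain ⟨φ, hφ, -⟩ := hwp.forward p.2
  obtain ⟨hφ2, hφ_le⟩ := hsm.forward _ φ hφ
  have hh := meshSize_nonneg T
  have hA := D.seminormA_nonneg (D.discW p.2)
  have hP := D.seminormP_nonneg (D.discError u p.1)
  have hS := D.seminormP_nonneg (D.interpErrorV u hu)
  have hφ_le' := mul_le_mul_of_nonneg_left hφ_le (mul_nonneg hcγ hh)
  have hplus := (happ.normPlus_interpErrorV_le φ hφ2).trans hφ_le'
  have hpi := (happ.boundV φ hφ2).trans hφ_le'
  have hcont1 := (hcont.cont1 φ hφ2 p.2).trans (mul_le_mul_of_nonneg_right hplus (by positivity))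
  have hsp₁ := (le_abs_self _).trans ((D.abs_sp_le (D.discError u p.1) (D.discV (D.piV φ))).trans
    (mul_le_mul_of_nonneg_left hpi hP))
  have hsp₂ := (neg_le_abs _).trans
    ((D.abs_sp_le (D.interpErrorV u hu) (D.discV (D.piV φ))).trans
      (mul_le_mul_of_nonneg_left hpi hS))
  refine le_of_sq_le_mul_self (by positivity) ?_
  calc ‖(p.2 : L2 Ω)‖ ^ 2
    _ = D.ah (D.incV φ hφ2) (D.discW p.2) :=
      ((hcons.forward _ φ hφ2 hφ (D.discW p.2)).trans (real_inner_self_eq_norm_sq _)).symm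
    _ = D.ah (D.interpErrorV φ hφ2) (D.discW p.2) + D.ah (D.discV (D.piV φ)) (D.discW p.2) := by
      rw [← LinearMap.add_apply, ← map_add, sub_add_cancel]
    _ = D.ah (D.interpErrorV φ hφ2) (D.discW p.2)
          + D.sp (D.discError u p.1) (D.discV (D.piV φ))
          + -D.sp (D.interpErrorV u hu) (D.discV (D.piV φ)) := by
      rw [hp.ah_adjoint, add_assoc, sub_eq_add_neg]
    _ ≤ _ := add_le_add (add_le_add hcont1 hsp₁) hsp₂
    _ = _ := by ring

-- Test the discrete forward equation with the interpolant of the adjoint solution with data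
-- `u - u_h`.
lemma IsFEMSol.norm_error_le (hp : D.IsFEMSol f u hu p) (hcΩ : 0 ≤ cΩ) (hcγ : 0 ≤ cγ)
    (hca : 0 ≤ ca) (hε : 0 ≤ ε) (hwp : P.WellPosed) (hsm : P.Smoothing cΩ) (hcons : D.Consistent)
    (hcont : D.Continuity ca ε) (happ : D.Approximation cγ) (hfu : P.IsForwardSol f u) :
    ‖(u : L2 Ω) - p.1‖ ≤ cγ * cΩ * meshSize T *
      (ca * D.normL (D.interpErrorV u hu) + ca * D.seminormP (D.discError u p.1)
        + D.seminormA (D.discW p.2) + ε * ‖(u : L2 Ω) - p.1‖) := by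
  obtain ⟨ψ, hψ, -⟩ := hwp.adjoint ((u : L2 Ω) - p.1)
  obtain ⟨hψ2, hψ_le⟩ := hsm.adjoint _ ψ hψ
  have hh := meshSize_nonneg T
  have hA := D.seminormA_nonneg (D.discW p.2)
  have hP := D.seminormP_nonneg (D.discError u p.1)
  have hψ_le' := mul_le_mul_of_nonneg_left hψ_le (mul_nonneg hcγ hh)
  have hstar := (happ.normStar_interpErrorW_le ψ hψ2).trans hψ_le'
  have hpi := (happ.boundW ψ hψ2).trans hψ_le'
  have hcont2 := (hcont.cont2 u hu ψ hψ2 p.1).trans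
    (mul_le_mul_of_nonneg_right hstar (by positivity))
  have hsa := (le_abs_self _).trans ((D.abs_sa_le (D.discW p.2) (D.discW (D.piW ψ))).trans
    (mul_le_mul_of_nonneg_left hpi hA))
  refine le_of_sq_le_mul_self (by positivity) ?_
  calc ‖(u : L2 Ω) - p.1‖ ^ 2
    _ = D.ah (D.incV u hu - D.discV p.1) (D.incW ψ hψ2) :=
      ((hcons.adjoint _ ψ hψ2 hψ (D.incV u hu - D.discV p.1)).trans
        (real_inner_self_eq_norm_sq ((u : L2 Ω) - p.1))).symm
    _ = D.ah (D.incV u hu - D.discV p.1) (D.interpErrorW ψ hψ2)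
          + D.ah (D.incV u hu - D.discV p.1) (D.discW (D.piW ψ)) := by
      rw [← map_add, sub_add_cancel]
    _ = D.ah (D.incV u hu - D.discV p.1) (D.interpErrorW ψ hψ2)
          + D.sa (D.discW p.2) (D.discW (D.piW ψ)) := by rw [hp.ah_forward hcons hfu]
    _ ≤ _ := add_le_add hcont2 hsa
    _ = _ := by ring

end Duality

section ErrorEstimates

variable {f : L2 Ω} {u : P.V} {hu : (u : L2 Ω) ∈ H Ω 2} {p : D.Vh × D.Wh}
  (hp : D.IsFEMSol f u hu p) (hcΩ : 0 ≤ cΩ) (hcγ : 0 ≤ cγ) (hca : 0 ≤ ca) (hε : 0 ≤ ε)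
  (hwp : P.WellPosed) (hsm : P.Smoothing cΩ) (hcons : D.Consistent) (hcont : D.Continuity ca ε)
  (happ : D.Approximation cγ) (hsmall : cγ * cΩ * meshSize T * ε ≤ 1 / 6)
include hp hcΩ hcγ hca hε hwp hsm hcons hcont happ hsmall

lemma IsFEMSol.norm_dual_le_stabNorm :
    ‖(p.2 : L2 Ω)‖ ≤ 6 / 5 * (cγ * cΩ * meshSize T *
      ((ca + 1) * D.stabNorm (D.discError u p.1) (D.discW p.2)
        + D.seminormP (D.interpErrorV u hu))) := by
  have ht : 0 ≤ cγ * cΩ * meshSize T := mul_nonneg (by positivity) (meshSize_nonneg T)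
  have hA := mul_le_mul_of_nonneg_left
    (D.seminormA_le_stabNorm (D.discError u p.1) (D.discW p.2)) hca
  have hP := D.seminormP_le_stabNorm (D.discError u p.1) (D.discW p.2)
  have hdual := hp.norm_dual_le hcΩ hcγ hca hε hwp hsm hcons hcont happ
  refine le_mul_of_le_mul_add_mul (norm_nonneg _) hsmall
    (hdual.trans (mul_le_mul_of_nonneg_left ?_ ht))
  linarith

variable (hfu : P.IsForwardSol f u)
include hfu

lemma IsFEMSol.norm_error_le_stabNorm :
    ‖(u : L2 Ω) - p.1‖ ≤ 6 / 5 * (cγ * cΩ * meshSize T *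
      ((ca + 1) * D.stabNorm (D.discError u p.1) (D.discW p.2)
        + ca * D.normL (D.interpErrorV u hu))) := by
  have ht : 0 ≤ cγ * cΩ * meshSize T := mul_nonneg (by positivity) (meshSize_nonneg T)
  have hA := D.seminormA_le_stabNorm (D.discError u p.1) (D.discW p.2)
  have hP := mul_le_mul_of_nonneg_left
    (D.seminormP_le_stabNorm (D.discError u p.1) (D.discW p.2)) hca
  have herror := hp.norm_error_le hcΩ hcγ hca hε hwp hsm hcons hcont happ hfu
  refine le_mul_of_le_mul_add_mul (norm_nonneg _) hsmall
    (herror.trans (mul_le_mul_of_nonneg_left ?_ ht))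
  linarith

lemma IsFEMSol.stabNorm_le :
    D.stabNorm (D.discError u p.1) (D.discW p.2) ≤ 2 * (ca + 1) * D.approxError u hu := by
  have hstab := hp.stabNorm_sq_le hcons hcont hfu
  have hdual := hp.norm_dual_le_stabNorm hcΩ hcγ hca hε hwp hsm hcons hcont happ hsmall
  have hη := D.approxError_nonneg u hu
  have hAη : D.normPlus (D.interpErrorV u hu) + D.seminormP (D.interpErrorV u hu) ≤
      D.approxError u hu := by
    have hL := apply_nonneg D.normL (D.interpErrorV u hu)
    rw [approxError]
    linarith
  have hP := D.seminormP_le_stabNorm (D.discError u p.1) (D.discW p.2)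
  have hx := D.seminormA_le_stabNorm (D.discError u p.1) (D.discW p.2)
  have hs := D.stabNorm_nonneg (D.discError u p.1) (D.discW p.2)
  have hA := apply_nonneg D.normPlus (D.interpErrorV u hu)
  have hS := D.seminormP_nonneg (D.interpErrorV u hu)
  generalize D.stabNorm (D.discError u p.1) (D.discW p.2) = s at *
  generalize D.normPlus (D.interpErrorV u hu) = A at *
  generalize D.seminormP (D.interpErrorV u hu) = S at *
  generalize D.approxError u hu = η at *
  have hεZ : ε * ‖(p.2 : L2 Ω)‖ ≤ 1 / 5 * ((ca + 1) * s + S) := by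
    have hε_dual := mul_le_mul_of_nonneg_left hdual hε
    have habsorb := mul_le_mul_of_nonneg_right hsmall (show 0 ≤ (ca + 1) * s + S by positivity)
    linarith
  have hquadratic : s ^ 2 ≤ 6 / 5 * (ca + 1) * η * s + (η / 2) ^ 2 := calc
    s ^ 2 ≤ A * (ca * s + 1 / 5 * ((ca + 1) * s + S)) + S * s :=
      hstab.trans (add_le_add (mul_le_mul_of_nonneg_left
        (add_le_add (mul_le_mul_of_nonneg_left hx hca) hεZ) hA) (mul_le_mul_of_nonneg_left hP hS))
    _ ≤ 6 / 5 * (ca + 1) * (A + S) * s + ((A + S) / 2) ^ 2 := by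
      nlinarith [mul_nonneg hca (mul_nonneg hS hs), mul_nonneg hA hs, mul_nonneg hS hs,
        sq_nonneg (A - S)]
    _ ≤ 6 / 5 * (ca + 1) * η * s + (η / 2) ^ 2 := by gcongr
  have hbound := le_add_of_sq_le_mul_add_sq (by positivity) (by positivity) hquadratic
  nlinarith [mul_nonneg hca hη]

lemma IsFEMSol.norm_dual_le_approxError :
    ‖(p.2 : L2 Ω)‖ ≤ 4 * (ca + 1) ^ 2 * (cγ * cΩ * meshSize T) * D.approxError u hu := by
  have ht : 0 ≤ cγ * cΩ * meshSize T := mul_nonneg (by positivity) (meshSize_nonneg T)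
  have hη := D.approxError_nonneg u hu
  have hstab := hp.stabNorm_le hcΩ hcγ hca hε hwp hsm hcons hcont happ hsmall hfu
  have hSη : D.seminormP (D.interpErrorV u hu) ≤ D.approxError u hu :=
    le_add_of_nonneg_left (add_nonneg (apply_nonneg _ _) (apply_nonneg _ _))
  calc _ ≤ _ := hp.norm_dual_le_stabNorm hcΩ hcγ hca hε hwp hsm hcons hcont happ hsmall
    _ ≤ 6 / 5 * (cγ * cΩ * meshSize T *
          ((ca + 1) * (2 * (ca + 1) * D.approxError u hu) + D.approxError u hu)) := by gcongr
    _ = (6 / 5 * (2 * (ca + 1) ^ 2 + 1)) * (cγ * cΩ * meshSize T * D.approxError u hu) := by ring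
    _ ≤ (4 * (ca + 1) ^ 2) * (cγ * cΩ * meshSize T * D.approxError u hu) :=
      mul_le_mul_of_nonneg_right (by nlinarith) (by positivity)
    _ = _ := by ring

lemma IsFEMSol.norm_error_le_approxError :
    ‖(u : L2 Ω) - p.1‖ ≤ 4 * (ca + 1) ^ 2 * (cγ * cΩ * meshSize T) * D.approxError u hu := by
  have ht : 0 ≤ cγ * cΩ * meshSize T := mul_nonneg (by positivity) (meshSize_nonneg T)
  have hη := D.approxError_nonneg u hu
  have hstab := hp.stabNorm_le hcΩ hcγ hca hε hwp hsm hcons hcont happ hsmall hfu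
  have hLη : D.normL (D.interpErrorV u hu) ≤ D.approxError u hu :=
    (le_add_of_nonneg_right (apply_nonneg D.normPlus (D.interpErrorV u hu))).trans
      (le_add_of_nonneg_right (D.seminormP_nonneg _))
  calc _ ≤ _ := hp.norm_error_le_stabNorm hcΩ hcγ hca hε hwp hsm hcons hcont happ hsmall hfu
    _ ≤ 6 / 5 * (cγ * cΩ * meshSize T *
          ((ca + 1) * (2 * (ca + 1) * D.approxError u hu) + ca * D.approxError u hu)) := by gcongr
    _ = (6 / 5 * (2 * (ca + 1) ^ 2 + ca)) * (cγ * cΩ * meshSize T * D.approxError u hu) := by ring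
    _ ≤ (4 * (ca + 1) ^ 2) * (cγ * cΩ * meshSize T * D.approxError u hu) :=
      mul_le_mul_of_nonneg_right (by nlinarith) (by positivity)
    _ = _ := by ring

end ErrorEstimates

section Convergence

variable {c : ℝ}

lemma meshSize_mul_hSeminorm_sub_le (hΩ : IsOpen Ω) (hc : 0 ≤ c)
    (hinv : InverseInequality Ω T k c) {v : L2 Ω} (hv : v ∈ H Ω 1) (vh wh : D.Vh) :
    meshSize T * hSeminorm Ω 1 (v - vh : L2 Ω) ≤
      meshSize T * hSeminorm Ω 1 (v - wh : L2 Ω) + c * (‖v - vh‖ + ‖v - wh‖) := by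
  have hdiff := D.Vh_fe _ (wh - vh).2
  have htriangle := hSeminorm_add_le hΩ (sub_mem hv (D.Vh_fe _ wh.2).1) hdiff.1
  rw [Submodule.coe_sub, sub_add_sub_cancel] at htriangle
  have hnorm : ‖(wh : L2 Ω) - vh‖ ≤ ‖v - vh‖ + ‖v - wh‖ := by
    rw [← sub_sub_sub_cancel_left]
    exact norm_sub_le _ _
  calc meshSize T * hSeminorm Ω 1 (v - vh : L2 Ω)
    _ ≤ meshSize T * hSeminorm Ω 1 (v - wh : L2 Ω)
          + meshSize T * hSeminorm Ω 1 (wh - vh : L2 Ω) := by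
      rw [← mul_add]
      exact mul_le_mul_of_nonneg_left htriangle (meshSize_nonneg T)
    _ ≤ _ := add_le_add le_rfl ((hinv _ hdiff).trans (mul_le_mul_of_nonneg_left hnorm hc))

lemma IsFEMSol.totalError_le {f : L2 Ω} {u : P.V} {hu : (u : L2 Ω) ∈ H Ω 2} {p : D.Vh × D.Wh}
    (hp : D.IsFEMSol f u hu p) (hcΩ : 0 ≤ cΩ) (hcγ : 0 ≤ cγ) (hca : 0 ≤ ca) (hε : 0 ≤ ε)
    (hc : 0 ≤ c) (hΩ : IsOpen Ω) (hinv : InverseInequality Ω T k c) (hwp : P.WellPosed)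
    (hsm : P.Smoothing cΩ) (hcons : D.Consistent) (hint : D.Interpolation ci)
    (hcont : D.Continuity ca ε) (happ : D.Approximation cγ)
    (hsmall : cγ * cΩ * meshSize T * ε ≤ 1 / 6) (hfu : P.IsForwardSol f u) {j : ℕ}
    (hj : j = 1 ∨ j = k) (huj : (u : L2 Ω) ∈ H Ω (j + 1)) :
    D.totalError u p ≤ (2 + c) * (4 * (ca + 1) ^ 2 * (cγ ^ 2 * cΩ) + ci)
      * meshSize T ^ (j + 1) * hSeminorm Ω (j + 1) (u : L2 Ω) := by
  have hh := meshSize_nonneg T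
  let A : ℝ := 4 * (ca + 1) ^ 2 * (cγ ^ 2 * cΩ)
  let Q : ℝ := meshSize T ^ (j + 1) * hSeminorm Ω (j + 1) (u : L2 Ω)
  have happrox : 4 * (ca + 1) ^ 2 * (cγ * cΩ * meshSize T) * D.approxError u hu ≤ A * Q := calc
    _ ≤ 4 * (ca + 1) ^ 2 * (cγ * cΩ * meshSize T)
          * (cγ * meshSize T ^ j * hSeminorm Ω (j + 1) (u : L2 Ω)) :=
      mul_le_mul_of_nonneg_left (happ.approx1 j hj u hu huj) (by positivity)
    _ = A * Q := by ring
  have hdual := (hp.norm_dual_le_approxError hcΩ hcγ hca hε hwp hsm hcons hcont happ hsmall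
    hfu).trans happrox
  have herror := (hp.norm_error_le_approxError hcΩ hcγ hca hε hwp hsm hcons hcont happ hsmall
    hfu).trans happrox
  have hgrad := D.meshSize_mul_hSeminorm_sub_le hΩ hc hinv (P.V_le u.2) p.1 (D.piV u)
  have hinterp : ‖(u : L2 Ω) - D.piV u‖
      + meshSize T * hSeminorm Ω 1 ((u : L2 Ω) - D.piV u : L2 Ω) ≤ ci * Q := by
    exact (le_add_of_nonneg_right (mul_nonneg (pow_nonneg hh 2) (Real.sqrt_nonneg _))).trans
      ((hint.piV j hj u huj).trans_eq (mul_assoc _ _ _))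
  have hgrad_interp := mul_nonneg hh (hSeminorm_nonneg Ω 1 ((u : L2 Ω) - D.piV u : L2 Ω))
  have hnorm_interp := norm_nonneg ((u : L2 Ω) - D.piV u)
  have hinverse := mul_le_mul_of_nonneg_left
    (add_le_add herror (show ‖(u : L2 Ω) - D.piV u‖ ≤ ci * Q by linarith)) hc
  calc D.totalError u p
    _ ≤ A * Q + (ci * Q + c * (A * Q + ci * Q)) + A * Q := by
      refine add_le_add (add_le_add herror (hgrad.trans (add_le_add ?_ hinverse))) hdual
      linarith
    _ ≤ (2 + c) * (A + ci) * Q := by linarith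
    _ = _ := (mul_assoc _ _ _).symm

end Convergence

lemma isFEMSol_iff (f : L2 Ω) (u : P.V) (hu : (u : L2 Ω) ∈ H Ω 2) (p : D.Vh × D.Wh) :
    D.IsFEMSol f u hu p ↔
      primalDualMap
        (D.ah.compl₁₂ (Submodule.inclusion le_sup_right) (Submodule.inclusion le_sup_right))
        (D.sa.compl₁₂ (Submodule.inclusion le_sup_right) (Submodule.inclusion le_sup_right))
        (D.sp.compl₁₂ (Submodule.inclusion le_sup_right) (Submodule.inclusion le_sup_right)) p =
      (innerₗ (L2 Ω) f ∘ₗ D.Wh.subtype,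
        -(D.sp (D.incV u hu) ∘ₗ Submodule.inclusion le_sup_right)) := by
  rw [Prod.ext_iff, LinearMap.ext_iff, LinearMap.ext_iff]
  refine and_congr Iff.rfl (forall_congr' fun vh => ?_)
  rw [sub_eq_neg_add]
  rfl

lemma eq_zero_of_totalError_nonpos {p : D.Vh × D.Wh} (hp : D.totalError 0 p ≤ 0) : p = 0 := by
  have hgrad := mul_nonneg (meshSize_nonneg T)
    (hSeminorm_nonneg Ω 1 (((0 : P.V) : L2 Ω) - p.1 : L2 Ω))
  have hprimal := norm_nonneg (((0 : P.V) : L2 Ω) - p.1)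
  have hdual := norm_nonneg (p.2 : L2 Ω)
  rw [totalError] at hp
  refine Prod.ext (Subtype.ext ?_) (Subtype.ext (norm_eq_zero.1 (by linarith)))
  have hzero : ‖((0 : P.V) : L2 Ω) - p.1‖ = 0 := by linarith
  simpa using hzero

lemma existsUnique_isFEMSol (hT : IsTriangulation Ω T)
    (hzero : ∀ p, D.IsFEMSol 0 0 (H Ω 2).zero_mem p → p = 0)
    (f : L2 Ω) (u : P.V) (hu : (u : L2 Ω) ∈ H Ω 2) : ∃! p, D.IsFEMSol f u hu p := by
  have := finiteDimensional_of_forall_isPolyOn hT fun v hv => (D.Vh_fe v hv).2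
  have := finiteDimensional_of_forall_isPolyOn hT fun w hw => (D.Wh_fe w hw).2
  simp only [isFEMSol_iff] at hzero ⊢
  refine (primalDualMap_bijective ?_).existsUnique _
  refine (injective_iff_map_eq_zero _).2 fun p hp => hzero p (hp.trans ?_)
  rw [show D.incV 0 (H Ω 2).zero_mem = 0 from rfl]
  ext <;> simp

end Discretisation

theorem mainTheorem1_general (d k : ℕ) {cΩ cγ ca ci σ τ : ℝ} (hcΩ : 0 < cΩ) (hcγ : 0 < cγ)
    (hca : 0 < ca) (hci : 0 < ci) (hσ : 0 < σ) (hτ : 0 < τ) :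
    ∃ C : ℝ, 0 < C ∧
      ∀ (Ω : Set (E d)) (P : Problem Ω) (T : SimplicialComplex ℝ (E d))
        (D : Discretisation P T k) (ε : ℝ),
        IsTriangulation Ω T → ShapeRegular T σ → QuasiUniform T τ →
        P.WellPosed → P.Smoothing cΩ →
        D.Consistent → D.Interpolation ci → 0 ≤ ε → D.Continuity ca ε →
        D.Approximation cγ →
        cγ * cΩ * meshSize T * ε ≤ 1 / 6 →
        ∀ (f : L2 Ω) (u : P.V) (hu : (u : L2 Ω) ∈ H Ω 2), P.IsForwardSol f u →
          ∃ p : D.Vh × D.Wh,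
            D.IsFEMSol f u hu p ∧ (∀ q : D.Vh × D.Wh, D.IsFEMSol f u hu q → q = p) ∧
            ((u : L2 Ω) ∈ H Ω (k + 1) →
              D.totalError u p
                ≤ C * meshSize T ^ (k + 1) * hSeminorm Ω (k + 1) (u : L2 Ω)) ∧
            D.totalError u p ≤ C * meshSize T ^ 2 * ‖f‖ := by
  obtain ⟨c, hc, hinv⟩ := exists_inverseInequality d k hσ.le hτ.le
  let B : ℝ := (2 + c) * (4 * (ca + 1) ^ 2 * (cγ ^ 2 * cΩ) + ci)
  have hB : 0 < B := by positivity
  refine ⟨B * (1 + cΩ), by positivity, fun Ω P T D ε hT hshape hquasi hwp hsm hcons hint hε hcont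
    happ hsmall f u hu hfu => ?_⟩
  have hh := meshSize_nonneg T
  have herror {f u hu p j} (hp : D.IsFEMSol f u hu p) (hfu : P.IsForwardSol f u)
      (hj : j = 1 ∨ j = k) (huj : (u : L2 Ω) ∈ H Ω (j + 1)) :
      D.totalError u p ≤ B * meshSize T ^ (j + 1) * hSeminorm Ω (j + 1) (u : L2 Ω) :=
    hp.totalError_le hcΩ.le hcγ.le hca.le hε hc hT.isOpen (hinv hT hshape hquasi) hwp hsm hcons
      hint hcont happ hsmall hfu hj huj
  have herror_data {f u hu p} (hp : D.IsFEMSol f u hu p) (hfu : P.IsForwardSol f u) :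
      D.totalError u p ≤ B * meshSize T ^ 2 * (cΩ * ‖f‖) :=
    (herror hp hfu (.inl rfl) hu).trans
      (mul_le_mul_of_nonneg_left (hsm.forward f u hfu).2 (by positivity))
  obtain ⟨p, hp, hunique⟩ := D.existsUnique_isFEMSol hT (fun q hq =>
    Discretisation.eq_zero_of_totalError_nonpos
      ((herror_data hq fun w => by simp).trans_eq (by simp))) f u hu
  refine ⟨p, hp, hunique, fun huk => (herror hp hfu (.inr rfl) huk).trans ?_,
    (herror_data hp hfu).trans ?_⟩
  · exact mul_le_mul_of_nonneg_right (mul_le_mul_of_nonneg_right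
      (le_mul_of_one_le_right hB.le (by linarith)) (by positivity)) (hSeminorm_nonneg _ _ _)
  · rw [← mul_assoc, mul_right_comm B]
    gcongr
    linarith

theorem mainTheorem1 (d k : ℕ) (hd : d = 2 ∨ d = 3) (hk : 1 ≤ k)
    (cΩ cγ : ℝ) (hcΩ : 0 < cΩ) (hcγ : 0 < cγ) :
    ∃ c₀ : ℝ, 0 < c₀ ∧
      ∀ ca ci σ τ : ℝ, 0 < ca → 0 < ci → 0 < σ → 0 < τ →
        ∃ C : ℝ, 0 < C ∧
          ∀ (Ω : Set (E d)) (P : Problem Ω) (T : SimplicialComplex ℝ (E d))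
            (D : Discretisation P T k) (ε : ℝ),
            IsTriangulation Ω T → ShapeRegular T σ → QuasiUniform T τ →
            P.WellPosed → P.Smoothing cΩ →
            D.Consistent → D.Interpolation ci → 0 ≤ ε → D.Continuity ca ε →
            D.Approximation cγ →
            c₀ * meshSize T * ε ≤ 1 / 6 →
            ∀ (f : L2 Ω) (u : P.V) (hu : (u : L2 Ω) ∈ H Ω 2), P.IsForwardSol f u →
              ∃ p : D.Vh × D.Wh,
                D.IsFEMSol f u hu p ∧ (∀ q : D.Vh × D.Wh, D.IsFEMSol f u hu q → q = p) ∧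
                ((u : L2 Ω) ∈ H Ω (k + 1) →
                  D.totalError u p
                    ≤ C * meshSize T ^ (k + 1) * hSeminorm Ω (k + 1) (u : L2 Ω)) ∧
                D.totalError u p ≤ C * meshSize T ^ 2 * ‖f‖ :=
  ⟨cγ * cΩ, by positivity, fun _ _ _ _ hca hci hσ hτ =>
    mainTheorem1_general d k hcΩ hcγ hca hci hσ hτ⟩
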